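/- Let $G$ be a nondiscrete locally compact second countable Hausdorff group with left Haar measure $\lambda$, and let $t>0$. A configuration on $G$ is a locally finite (equivalently, closed and discrete) subset $\omega\subset G$, and a $[0,1]$-marked configuration on $G$ is a locally finite subset of $G\times[0,1]$ that contains at most one point $(g,x)$ for each $g\in G$. The spaces $\mathbb M$ of configurations and $[0,1]^{\mathbb M}$ of marked configurations carry the $\sigma$-algebras generated by the point counts $N_U(\omega)=|\omega\cap U|$, $U$ Borel in $G$ respectively in $G\times[0,1]$. The group $G$ acts on $[0,1]^{\mathbb M}$ by $g\cdot\omega=\{(gh,x):(h,x)\in\omega\}$. Let $\mu$ be the law on $\mathbb M$ of the Poisson point process of intensity $t$: for every Borel $U\subseteq G$ the variable $N_U$ is Poisson distributed with parameter $t\lambda(U)$ (almost surely infinite if $\lambda(U)=\infty$), and $N_U$, $N_V$ are independent whenever $U,V$ are disjoint Borel sets. Let $\nu=[0,1]^{\mu}$ be the law of its IID version: sample $\omega$ from $\mu$ and, given $\omega$, mark its points by independent $\mathrm{Unif}[0,1]$ labels. For a probability space $(Y,\eta)$ let $\mathrm{Aut}(Y,\eta)$ be the set of measurable automorphisms of $Y$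 preserving $\eta$, identified when they agree $\eta$-almost everywhere, with the weak topology: the weakest topology making $T\mapsto\eta(TA\,\triangle\,B)$ continuous for all measurable $A,B\subseteq Y$. Proposition. The measure $\nu$ is a $G$-invariant probability measure, and the action $G\curvearrowright([0,1]^{\mathbb M},\nu)$ is malleable: writing $X=[0,1]^{\mathbb M}$, there is a continuous path $\gamma:[0,1]\to\mathrm{Aut}(X\times X,\nu\otimes\nu)$ from the identity to the flip $(x,y)\mapsto(y,x)$ such that for every $s\in[0,1]$ the element $\gamma_s$ commutes with the diagonal action of $G$, i.e. for every $g\in G$ one has $\gamma_s(gx,gy)=g\,\gamma_s(x,y)$ for $\nu\otimes\nu$-almost every $(x,y)$. -/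

import Mathlib

open MeasureTheory ProbabilityTheory
open scoped ENNReal NNReal unitInterval

noncomputable section

/-! ### Configuration spaces -/

/-- The configuration space `𝕄(Z)`: all locally finite subsets of `Z`. In a locally compact Hausdorff
space these are exactly the closed and discrete subsets (see `isLocallyFiniteSet_iff`). -/
def Config (Z : Type*) [TopologicalSpace Z] : Type _ :=
  {ω : Set Z // ∀ K : Set Z, IsCompact K → (ω ∩ K).Finite}

namespace Config

variable {Z : Type*} [TopologicalSpace Z]

/-- The point counting function `N_U(ω) = |ω ∩ U|`. -/
def count (U : Set Z) (ω : Config Z) : ℕ∞ := (ω.1 ∩ U).encard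

/-- The Borel structure on `𝕄(Z)`: the smallest one for which `N_U` is measurable for every Borel
set `U`. -/
instance [MeasurableSpace Z] : MeasurableSpace (Config Z) :=
  ⨆ U : {U : Set Z // MeasurableSet U}, MeasurableSpace.comap (count U.1) inferInstance

theorem measurable_count [MeasurableSpace Z] {U : Set Z} (hU : MeasurableSet U) :
    Measurable (count U) :=
  Measurable.of_comap_le
    (le_iSup (fun U : {U : Set Z // MeasurableSet U} =>
      MeasurableSpace.comap (count U.1) inferInstance) ⟨U, hU⟩)

/-- The image of a configuration under a homeomorphism. -/
def map (e : Z ≃ₜ Z) (ω : Config Z) : Config Z :=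
  ⟨e '' ω.1, fun K hK => by
    have h : e '' ω.1 ∩ K = e '' (ω.1 ∩ e ⁻¹' K) := Set.image_inter_preimage e ω.1 K |>.symm
    rw [h]
    exact (ω.2 _ (e.isCompact_preimage.2 hK)).image _⟩

theorem measurable_map [MeasurableSpace Z] [BorelSpace Z] (e : Z ≃ₜ Z) : Measurable (map e) := by
  refine Measurable.of_le_map (iSup_le ?_)
  rintro ⟨U, hU⟩
  rw [MeasurableSpace.comap_le_iff_le_map]
  have h : count U ∘ map e = count (e ⁻¹' U) := by
    funext ω
    have h2 : e '' ω.1 ∩ U = e '' (ω.1 ∩ e ⁻¹' U) := Set.image_inter_preimage e ω.1 U |>.symm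
    simp only [Function.comp, count, map, h2]
    exact e.injective.encard_image _
  intro s hs
  change MeasurableSet ((count U ∘ map e) ⁻¹' s)
  rw [h]
  exact measurable_count (hU.preimage e.measurable) hs

end Config

/-- Local finiteness is the same as being closed and discrete. -/
theorem isLocallyFiniteSet_iff {Z : Type*} [TopologicalSpace Z] [T2Space Z] [LocallyCompactSpace Z]
    (ω : Set Z) :
    (∀ K : Set Z, IsCompact K → (ω ∩ K).Finite) ↔ IsClosed ω ∧ DiscreteTopology ω := by
  constructor
  · intro h
    have key : ∀ x : Z, ∃ V : Set Z, IsOpen V ∧ x ∈ V ∧ ∀ y ∈ ω ∩ V, y = x := by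
      intro x
      obtain ⟨K, hK, hx⟩ := exists_compact_mem_nhds x
      refine ⟨interior K \ ((ω ∩ K) \ {x}),
        isOpen_interior.sdiff ((h K hK).subset Set.sdiff_subset).isClosed,
        ⟨mem_interior_iff_mem_nhds.2 hx, fun h' => h'.2 rfl⟩, ?_⟩
      rintro y ⟨hy, hyK, hy'⟩
      by_contra hne
      exact hy' ⟨⟨hy, interior_subset hyK⟩, hne⟩
    constructor
    · rw [← isOpen_compl_iff, isOpen_iff_forall_mem_open]
      intro x hx
      obtain ⟨V, hV, hxV, hy⟩ := key x
      exact ⟨V, fun y hyV hyω => hx (hy y ⟨hyω, hyV⟩ ▸ hyω), hV, hxV⟩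
    · refine discreteTopology_iff_isOpen_singleton.2 fun x => ?_
      obtain ⟨V, hV, hxV, hy⟩ := key x
      refine ⟨V, hV, ?_⟩
      ext y
      refine ⟨fun hyV => Subtype.ext (hy y ⟨y.2, hyV⟩), ?_⟩
      rintro rfl
      exact hxV
  · rintro ⟨hc, hd⟩ K hK
    exact (hK.inter_left hc).finite (IsDiscrete.mono ⟨hd⟩ Set.inter_subset_left)

/-- The `[0,1]`-marked configuration space `[0,1]^𝕄(G)`: configurations on `G × [0,1]` in which every
point of `G` carries at most one mark. Its Borel structure is that of a subspace of
`𝕄(G × [0,1])`. -/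
abbrev MarkedConfig (G : Type*) [TopologicalSpace G] : Type _ :=
  {ω : Config (G × I) // ∀ (g : G) (x y : I), (g, x) ∈ ω.1 → (g, y) ∈ ω.1 → x = y}

namespace MarkedConfig

variable {G : Type*} [Group G] [TopologicalSpace G] [IsTopologicalGroup G]

/-- The homeomorphism `(h, x) ↦ (g h, x)` of `G × [0,1]`. -/
def shift (g : G) : (G × I) ≃ₜ (G × I) := (Homeomorph.mulLeft g).prodCongr (Homeomorph.refl I)

/-- `G` acts on marked configurations by left translation, the marks being carried along:
`g • ω = {(g h, x) | (h, x) ∈ ω}`. -/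
instance : MulAction G (MarkedConfig G) where
  smul g ω := ⟨Config.map (shift g) ω.1, by
    rintro h x y ⟨⟨a, x'⟩, hx, hx'⟩ ⟨⟨b, y'⟩, hy, hy'⟩
    obtain ⟨h1, rfl⟩ := Prod.mk.inj hx'
    obtain ⟨h2, rfl⟩ := Prod.mk.inj hy'
    obtain rfl : a = b := mul_left_cancel (h1.trans h2.symm)
    exact ω.2 a _ _ hx hy⟩
  one_smul ω := by
    apply Subtype.ext; apply Subtype.ext
    change (shift (1 : G)) '' ω.1.1 = ω.1.1
    have : (shift (1 : G) : G × I → G × I) = id := by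
      funext p; exact Prod.ext (one_mul p.1) rfl
    rw [this, Set.image_id]
  mul_smul g h ω := by
    apply Subtype.ext; apply Subtype.ext
    change (shift (g * h)) '' ω.1.1 = shift g '' (shift h '' ω.1.1)
    rw [Set.image_image]
    refine Set.image_congr fun p _ => ?_
    exact Prod.ext (mul_assoc g h p.1) rfl

theorem coe_smul (g : G) (ω : MarkedConfig G) :
    (g • ω).1.1 = (fun p : G × I => (g * p.1, p.2)) '' ω.1.1 := rfl

instance [MeasurableSpace G] [BorelSpace G] [SecondCountableTopology G] :
    MeasurableConstSMul G (MarkedConfig G) where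
  measurable_const_smul g :=
    Measurable.subtype_mk ((Config.measurable_map (shift g)).comp measurable_subtype_coe)

end MarkedConfig

/-! ### The Poisson point process and its IID version -/

/-- The law of a Poisson distributed random variable of parameter `a ∈ [0, ∞]`; for `a = ∞` the
variable is infinite almost surely. -/
def poissonLaw (a : ℝ≥0∞) : Measure ℕ∞ :=
  if a = ∞ then Measure.dirac ⊤ else (poissonMeasure a.toNNReal).map (fun n : ℕ => (n : ℕ∞))

/-- The probability measure `μ` is the law of a Poisson point process on `Z` of intensity `t` with respect to `lam`. -/
structure IsPoissonPointProcess {Z : Type*} [TopologicalSpace Z] [MeasurableSpace Z]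
    (lam : Measure Z) (t : ℝ≥0) (μ : Measure (Config Z)) : Prop where
  poisson_counts : ∀ U : Set Z, MeasurableSet U →
    μ.map (Config.count U) = poissonLaw (t * lam U)
  total_independence : ∀ U V : Set Z, MeasurableSet U → MeasurableSet V → Disjoint U V →
    IndepFun (Config.count U) (Config.count V) μ

section IID

variable {G : Type*} [TopologicalSpace G]

/-- The configuration `ω`, with the point `g ∈ ω` marked by `u g`. -/
def Config.label (ω : Config G) (u : ω.1 → I) : MarkedConfig G :=
  ⟨⟨Set.range fun g : ω.1 => ((g : G), u g), fun K hK => by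
    have hf : (ω.1 ∩ Prod.fst '' K).Finite := ω.2 _ (hK.image continuous_fst)
    have hf' : {g : ω.1 | (g : G) ∈ Prod.fst '' K}.Finite := by
      refine Set.Finite.of_finite_image (f := Subtype.val) (hf.subset ?_)
        Subtype.val_injective.injOn
      rintro _ ⟨g, hg, rfl⟩
      exact ⟨g.2, hg⟩
    refine (hf'.image fun g : ω.1 => ((g : G), u g)).subset ?_
    rintro _ ⟨⟨g, rfl⟩, hg⟩
    exact ⟨g, ⟨_, hg, rfl⟩, rfl⟩⟩, by
    rintro g x y ⟨a, ha⟩ ⟨b, hb⟩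
    obtain ⟨h1, rfl⟩ := Prod.mk.inj ha
    obtain ⟨h2, rfl⟩ := Prod.mk.inj hb
    obtain rfl : a = b := Subtype.ext (h1.trans h2.symm)
    rfl⟩

variable [MeasurableSpace G]

/-- The law of the random marked configuration obtained from the fixed configuration `ω` by giving its
points independent `Unif[0,1]` marks. -/
def Config.labelLaw (ω : Config G) : Measure (MarkedConfig G) :=
  (Measure.infinitePi fun _ : ω.1 => (volume : Measure I)).map ω.label

/-- The law `[0,1]^μ` of the IID version of a point process with law `μ`: sample `ω` from `μ`, then
give the points of `ω` independent `Unif[0,1]` marks. -/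
def iidLaw (μ : Measure (Config G)) : Measure (MarkedConfig G) := μ.bind Config.labelLaw

instance (μ : Measure (Config G)) [IsFiniteMeasure μ] : IsFiniteMeasure (iidLaw μ) where
  measure_univ_lt_top := by
    have h1 : ∀ ω : Config G, ω.labelLaw Set.univ ≤ 1 := fun ω => by
      by_cases h : AEMeasurable ω.label (Measure.infinitePi fun _ : ω.1 => (volume : Measure I))
      · rw [Config.labelLaw, Measure.map_apply_of_aemeasurable h MeasurableSet.univ]
        exact prob_le_one
      · rw [Config.labelLaw, Measure.map_of_not_aemeasurable h]
        simp
    calc iidLaw μ Set.univ ≤ ∫⁻ ω, ω.labelLaw Set.univ ∂μ :=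
          Measure.bind_apply_le _ MeasurableSet.univ
      _ ≤ ∫⁻ _, 1 ∂μ := lintegral_mono h1
      _ < ∞ := by simp

end IID

/-! ### The automorphism group of a measure space, and malleability -/

/-- The measurable automorphisms of `X` that preserve `μ`. -/
def MPEquiv {X : Type*} [MeasurableSpace X] (μ : Measure X) : Type _ :=
  {T : X ≃ᵐ X // MeasurePreserving T μ μ}

/-- Equality almost everywhere. -/
instance MPEquiv.setoid {X : Type*} [MeasurableSpace X] (μ : Measure X) : Setoid (MPEquiv μ) where
  r S T := ∀ᵐ x ∂μ, S.1 x = T.1 x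
  iseqv :=
    { refl := fun _ => Filter.Eventually.of_forall fun _ => rfl
      symm := fun h => h.mono fun _ hx => hx.symm
      trans := fun h h' => by filter_upwards [h, h'] with x hx hx' using hx.trans hx' }

/-- `Aut(X, μ)`: measure preserving automorphisms, up to equality almost everywhere. -/
def MPAut {X : Type*} [MeasurableSpace X] (μ : Measure X) : Type _ := Quotient (MPEquiv.setoid μ)

namespace MPAut

variable {X : Type*} [MeasurableSpace X] {μ : Measure X}

/-- The class of an automorphism. -/
def mk (T : MPEquiv μ) : MPAut μ := Quotient.mk _ T

/-- The function `T ↦ μ(TA ∆ B)`, for Borel sets `A` and `B`. -/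
def measureSymmDiff (A B : {A : Set X // MeasurableSet A}) : MPAut μ → ℝ≥0∞ :=
  Quotient.lift (fun T : MPEquiv μ => μ (symmDiff (T.1 '' A.1) B.1)) fun S T hST => by
    have key : ∀ R : MPEquiv μ, μ (symmDiff (R.1 '' A.1) B.1) = μ (symmDiff A.1 (R.1 ⁻¹' B.1)) := by
      intro R
      have hm : MeasurableSet (symmDiff (R.1 '' A.1) B.1) :=
        (R.1.measurableSet_image.2 A.2).symmDiff B.2
      rw [← R.2.measure_preimage hm.nullMeasurableSet, Set.preimage_symmDiff,
        R.1.injective.preimage_image]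
    change μ (symmDiff (S.1 '' A.1) B.1) = μ (symmDiff (T.1 '' A.1) B.1)
    rw [key, key]
    refine measure_congr ?_
    refine Filter.EventuallyEq.symmDiff (ae_eq_refl _) ?_
    exact hST.mono fun x hx => by
      change (S.1 x ∈ B.1) = (T.1 x ∈ B.1)
      rw [hx]

/-- The weak topology on `Aut(X, μ)`: the weakest topology that makes all the functions
`T ↦ μ(TA ∆ B)` continuous. -/
instance : TopologicalSpace (MPAut μ) :=
  ⨅ A : {A : Set X // MeasurableSet A}, ⨅ B : {B : Set X // MeasurableSet B},
    TopologicalSpace.induced (measureSymmDiff A B) inferInstance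

/-- The identity. -/
instance : One (MPAut μ) := ⟨mk ⟨MeasurableEquiv.refl X, MeasurePreserving.id μ⟩⟩

/-- The flip `(x, y) ↦ (y, x)`. -/
def flip (μ : Measure X) [SFinite μ] : MPAut (μ.prod μ) :=
  mk ⟨MeasurableEquiv.prodComm, Measure.measurePreserving_swap⟩

end MPAut

/-- `T ∈ Aut(X × X, μ ⊗ μ)` commutes with the diagonal action of `G`: for every `g`,
`T (g x, g y) = g T(x, y)` for almost every `(x, y)`. -/
def CommutesWithDiagonal (G : Type*) {X : Type*} [Group G] [MulAction G X] [MeasurableSpace X]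
    {μ : Measure X} (T : MPAut (μ.prod μ)) : Prop :=
  ∀ S : MPEquiv (μ.prod μ), MPAut.mk S = T →
    ∀ g : G, ∀ᵐ p ∂(μ.prod μ), S.1 (g • p) = g • S.1 p

/-- The action of `G` on `(X, μ)` is malleable: in `Aut(X × X, μ ⊗ μ)` there is a continuous path from
the identity to the flip through elements that commute with the diagonal action. -/
def IsMalleable (G : Type*) {X : Type*} [Group G] [MulAction G X] [MeasurableSpace X]
    (μ : Measure X) [SFinite μ] : Prop :=
  ∃ γ : Path (1 : MPAut (μ.prod μ)) (MPAut.flip μ), ∀ t : I, CommutesWithDiagonal G (γ t)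

end

/-! The IID version of a Poisson process behaves like a Poisson process on `G × I` of intensity `t •
(lam ⊗ volume)`: a relatively compact Borel set `V` is avoided with probability `exp (-t * (lam ⊗
volume) V)` (`iidLaw_avoid`). By Rényi's principle (`ext_of_avoid`) these probabilities determine
the law, so invariance of the intensity under left translation gives invariance of `iidLaw μ`.

For malleability, take two independent copies and let the path at time `s` exchange the points whose
marks lie below `s`. Haar measure has no atoms because `G` is not discrete, so almost surely the two
copies have no common point of `G`, and the exchange yields two legitimate marked configurations. At
`s = 0` nothing moves; at `s = 1` almost surely everything does, which is the flip. Translation does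
not touch marks, so the exchange is equivariant.

The exchange preserves measure because it pulls a rectangle `avoid U ×ˢ avoid V` back to the
rectangle in which `U` and `V` have swapped their parts with marks in `D`
(`exchange_mem_avoid_prod`); the total intensity in the exponent is unchanged (`iidLaw_avoid_mul`).
For continuity, the events seen inside a compact set at times `r` and `s` can differ only if some
point there has its mark between `r` and `s`, with probability `O(|s - r|)`. An induction over the
generated σ-algebra extends this to all measurable sets. -/

noncomputable section

open Set Filter Topology TopologicalSpace

/-! ### Avoidance events and the σ-algebra of point counts -/

namespace Config

variable {Z : Type*} [TopologicalSpace Z]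

/-- The configurations without points in `U`. -/
def avoid (U : Set Z) : Set (Config Z) := {ω | Disjoint ω.1 U}

theorem avoid_empty : avoid (∅ : Set Z) = univ := by
  simp [avoid]

theorem avoid_union (U V : Set Z) : avoid (U ∪ V) = avoid U ∩ avoid V := by
  ext ω
  exact disjoint_union_right

theorem avoid_iUnion {ι : Sort*} (U : ι → Set Z) : avoid (⋃ i, U i) = ⋂ i, avoid (U i) := by
  ext ω
  simp [avoid]

theorem avoid_eq_preimage_count (U : Set Z) : avoid U = count U ⁻¹' {0} := by
  ext ω
  simp [avoid, count, disjoint_iff_inter_eq_empty]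

theorem measurableSet_avoid [MeasurableSpace Z] {U : Set Z} (hU : MeasurableSet U) :
    MeasurableSet (avoid U) := by
  rw [avoid_eq_preimage_count]
  exact measurable_count hU (measurableSet_singleton 0)

/-- The events `avoid U`, for relatively compact Borel subsets `U` of `W`. -/
def avoidSets [MeasurableSpace Z] (W : Set Z) : Set (Set (Config Z)) :=
  avoid '' {U | MeasurableSet U ∧ U ⊆ W ∧ ∃ K, IsCompact K ∧ U ⊆ K}

theorem isPiSystem_avoidSets [MeasurableSpace Z] (W : Set Z) : IsPiSystem (avoidSets W) := by
  rintro _ ⟨U, ⟨hU, hUW, K, hK, hUK⟩, rfl⟩ _ ⟨V, ⟨hV, hVW, L, hL, hVL⟩, rfl⟩ -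
  exact ⟨U ∪ V, ⟨hU.union hV, union_subset hUW hVW, K ∪ L, hK.union hL,
    union_subset_union hUK hVL⟩, avoid_union U V⟩

theorem generateFrom_avoidSets_le [MeasurableSpace Z] (W : Set Z) :
    MeasurableSpace.generateFrom (avoidSets W) ≤ (inferInstance : MeasurableSpace (Config Z)) := by
  refine MeasurableSpace.generateFrom_le ?_
  rintro _ ⟨U, hU, rfl⟩
  exact measurableSet_avoid hU.1

/-- A configuration has at least `k` points in `W` if and only if there are `k` disjoint basic open
sets that all contain points of `ω ∩ W`. -/
theorem le_count_iff [T2Space Z] [SecondCountableTopology Z] (W : Set Z) (k : ℕ) (ω : Config Z) :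
    (k : ℕ∞) ≤ count W ω ↔ ∃ v : Fin k → countableBasis Z,
      Pairwise (Function.onFun Disjoint fun i => (v i : Set Z)) ∧ ∀ i, ω ∉ avoid (W ∩ v i) := by
  constructor
  · intro h
    obtain ⟨s, hs, hsk⟩ := exists_subset_encard_eq h
    have hfin : s.Finite := finite_of_encard_eq_coe hsk
    obtain ⟨U, hU, hd⟩ := s.pairwiseDisjoint_nhds.exists_mem_filter_basis hfin
      fun x => (isBasis_countableBasis Z).nhds_hasBasis (a := x)
    have hcard : hfin.toFinset.card = k := by
      rw [hfin.encard_eq_coe_toFinset_card] at hsk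
      exact_mod_cast hsk
    let e : Fin k ≃ hfin.toFinset := (hfin.toFinset.equivFinOfCardEq hcard).symm
    have he : ∀ i, (e i : Z) ∈ s := fun i => hfin.mem_toFinset.1 (e i).2
    refine ⟨fun i => ⟨U (e i), (hU _).1⟩, fun i j hij => hd (he i) (he j) fun h => hij ?_, ?_⟩
    · exact e.injective (Subtype.ext h)
    · intro i hi
      exact Set.disjoint_left.1 hi (hs (he i)).1 ⟨(hs (he i)).2, (hU _).2⟩
  · rintro ⟨v, hv, h⟩
    have h' : ∀ i, ∃ x, x ∈ ω.1 ∧ x ∈ W ∩ v i := fun i => Set.not_disjoint_iff.1 (h i)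
    choose x hx hxv using h'
    have hinj : Function.Injective x := fun i j hij => by
      by_contra hne
      exact Set.disjoint_left.1 (hv hne) (hxv i).2 (hij ▸ (hxv j).2)
    calc (k : ℕ∞) = (range x).encard := by
          rw [← image_univ, hinj.encard_image]; simp
      _ ≤ count W ω := encard_le_encard (range_subset_iff.2 fun i => ⟨hx i, (hxv i).1⟩)

section Generate

variable [MeasurableSpace Z] [BorelSpace Z] [T2Space Z] [LocallyCompactSpace Z]
  [SecondCountableTopology Z]

/-- Relative compactness costs nothing: cut `U` by a countable compact covering. -/
theorem measurableSet_generateFrom_avoidSets {U W : Set Z} (hU : MeasurableSet U) (hUW : U ⊆ W) :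
    MeasurableSet[MeasurableSpace.generateFrom (avoidSets W)] (avoid U) := by
  have h : U = ⋃ n, U ∩ compactCovering Z n := by
    rw [← inter_iUnion, iUnion_compactCovering, inter_univ]
  rw [h, avoid_iUnion]
  refine MeasurableSet.iInter fun n => MeasurableSpace.measurableSet_generateFrom
    ⟨_, ⟨hU.inter (isCompact_compactCovering Z n).measurableSet, inter_subset_left.trans hUW,
      _, isCompact_compactCovering Z n, inter_subset_right⟩, rfl⟩

/-- By `le_count_iff`, `k ≤ count W` is a countable union of finite intersections of complements of
avoidance events. Only subsets of `W` occur; this locality is what later gives independence of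
counts over disjoint sets. -/
theorem measurable_count_generateFrom_avoidSets {W : Set Z} (hW : MeasurableSet W) :
    Measurable[MeasurableSpace.generateFrom (avoidSets W)] (count W) := by
  have key : ∀ k : ℕ, MeasurableSet[MeasurableSpace.generateFrom (avoidSets W)]
      {ω | (k : ℕ∞) ≤ count W ω} := by
    intro k
    have h : {ω : Config Z | (k : ℕ∞) ≤ count W ω} =
        ⋃ v : {v : Fin k → countableBasis Z //
          Pairwise (Function.onFun Disjoint fun i => (v i : Set Z))},
          ⋂ i, (avoid (W ∩ v.1 i))ᶜ := by
      ext ω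
      simp only [mem_ofPred_eq, le_count_iff, mem_iUnion, mem_iInter, mem_compl_iff, Subtype.exists,
        exists_prop]
    rw [h]
    have : Countable (countableBasis Z) := (countable_countableBasis Z).to_subtype
    refine MeasurableSet.iUnion fun v => MeasurableSet.iInter fun i => MeasurableSet.compl ?_
    exact measurableSet_generateFrom_avoidSets
      (hW.inter (isOpen_of_mem_countableBasis (v.1 i).2).measurableSet) inter_subset_left
  refine (@ENat.measurable_iff _ (MeasurableSpace.generateFrom (avoidSets W)) _).2 fun n => ?_
  have h : count W ⁻¹' {(n : ℕ∞)} =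
      {ω | (n : ℕ∞) ≤ count W ω} \ {ω | ((n + 1 : ℕ) : ℕ∞) ≤ count W ω} := by
    ext ω
    simp only [mem_preimage, mem_singleton_iff, Set.mem_sdiff, mem_ofPred_eq, not_le, Nat.cast_add,
      Nat.cast_one, ENat.lt_natCast_add_one_iff]
    exact ⟨fun h => ⟨h.ge, h.le⟩, fun h => le_antisymm h.2 h.1⟩
  rw [h]
  exact @MeasurableSet.diff _ (MeasurableSpace.generateFrom (avoidSets W)) _ _ (key n) (key (n + 1))

theorem generateFrom_avoidSets_univ :
    (inferInstance : MeasurableSpace (Config Z)) =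
      MeasurableSpace.generateFrom (avoidSets (univ : Set Z)) := by
  refine le_antisymm (iSup_le ?_) (generateFrom_avoidSets_le _)
  rintro ⟨U, hU⟩
  refine Measurable.comap_le ?_
  refine (measurable_count_generateFrom_avoidSets hU).mono
    (MeasurableSpace.generateFrom_mono (image_mono ?_)) le_rfl
  exact fun V hV => ⟨hV.1, subset_univ V, hV.2.2⟩

end Generate

end Config

/-! ### Exponentials and generating functions of Poisson laws -/

/-- The function `a ↦ e^{-a}`, for finite `a`. -/
def expNeg (a : ℝ≥0∞) : ℝ≥0∞ := ENNReal.ofReal (Real.exp (-a.toReal))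

/-- Since `toReal ∞ = 0`, the value `expNeg ∞` is `1` and not `0`; hence the finiteness assumptions.
-/
theorem expNeg_add {a b : ℝ≥0∞} (ha : a ≠ ∞) (hb : b ≠ ∞) :
    expNeg (a + b) = expNeg a * expNeg b := by
  rw [expNeg, ENNReal.toReal_add ha hb, neg_add, Real.exp_add,
    ENNReal.ofReal_mul (Real.exp_nonneg _), expNeg, expNeg]

theorem expNeg_sum {ι : Type*} (s : Finset ι) (a : ι → ℝ≥0∞) (ha : ∀ i ∈ s, a i ≠ ∞) :
    expNeg (∑ i ∈ s, a i) = ∏ i ∈ s, expNeg (a i) := by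
  rw [expNeg, ENNReal.toReal_sum ha, ← Finset.sum_neg_distrib, Real.exp_sum,
    ENNReal.ofReal_prod_of_nonneg fun _ _ => Real.exp_nonneg _]
  rfl

/-- Turns avoidance probabilities into first-moment bounds on the probability of hitting a set. -/
theorem one_sub_expNeg_le (a : ℝ≥0∞) : 1 - expNeg a ≤ a := by
  rcases eq_or_ne a ∞ with rfl | ha
  · exact le_top
  · lift a to ℝ≥0 using ha
    have h : (1 : ℝ≥0∞) ≤ ENNReal.ofReal (a + Real.exp (-a)) := by
      rw [ENNReal.one_le_ofReal]
      linarith [Real.add_one_le_exp (-(a : ℝ))]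
    rw [ENNReal.ofReal_add a.coe_nonneg (Real.exp_nonneg _), ENNReal.ofReal_coe_nnreal] at h
    exact tsub_le_iff_right.2 h

theorem tendsto_expNeg {a : ℝ≥0∞} (ha : a ≠ ∞) : Tendsto expNeg (𝓝 a) (𝓝 (expNeg a)) :=
  (ENNReal.continuous_ofReal.tendsto _).comp
    ((Real.continuous_exp.tendsto _).comp ((ENNReal.tendsto_toReal ha).neg))

theorem lintegral_pow_poissonMeasure (r : ℝ≥0) {c : ℝ≥0∞} (hc : c ≤ 1) :
    ∫⁻ n, c ^ n ∂(poissonMeasure r) = expNeg (r * (1 - c)) := by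
  have hc' : c ≠ ∞ := ne_top_of_le_ne_top ENNReal.one_ne_top hc
  lift c to ℝ≥0 using hc'
  have hc1 : c ≤ 1 := by exact_mod_cast hc
  have hsum : HasSum (fun n : ℕ => Real.exp (-r) * r ^ n / n.factorial * (c : ℝ) ^ n)
      (Real.exp (-r) * Real.exp (r * c)) := by
    convert! (NormedSpace.expSeries_div_hasSum_exp ((r : ℝ) * c)).mul_left (Real.exp (-r)) using 1
    · funext n
      rw [mul_pow]
      ring
    · rw [← Real.exp_eq_exp_ℝ]
  calc ∫⁻ n, (c : ℝ≥0∞) ^ n ∂(poissonMeasure r)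
      = ∑' n : ℕ, ENNReal.ofReal (Real.exp (-r) * r ^ n / n.factorial * (c : ℝ) ^ n) := by
        rw [poissonMeasure, lintegral_sum_measure]
        refine tsum_congr fun n => ?_
        rw [lintegral_smul_measure, lintegral_dirac, smul_eq_mul,
          ENNReal.ofReal_mul (by positivity), ENNReal.ofReal_pow (by positivity),
          ENNReal.ofReal_coe_nnreal]
    _ = ENNReal.ofReal (Real.exp (-r) * Real.exp (r * c)) := by
        rw [← hsum.tsum_eq, ENNReal.ofReal_tsum_of_nonneg (fun n => by positivity) hsum.summable]
    _ = expNeg (r * (1 - c)) := by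
        rw [expNeg, ← Real.exp_add, ENNReal.toReal_mul, ENNReal.toReal_sub_of_le hc
          ENNReal.one_ne_top]
        congr 2
        simp
        ring

/-- For finite `a` the count is almost surely finite, so the default `toNat ⊤ = 0` has no effect. -/
theorem lintegral_pow_poissonLaw {a c : ℝ≥0∞} (ha : a ≠ ∞) (hc : c ≤ 1) :
    ∫⁻ n, c ^ n.toNat ∂(poissonLaw a) = expNeg (a * (1 - c)) := by
  rw [poissonLaw, if_neg ha, lintegral_map .of_discrete .of_discrete]
  simp only [ENat.toNat_natCast]
  rw [lintegral_pow_poissonMeasure _ hc, ENNReal.coe_toNNReal ha]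

theorem poissonLaw_singleton_zero {a : ℝ≥0∞} (ha : a ≠ ∞) : poissonLaw a {0} = expNeg a := by
  have h : ((fun n : ℕ => (n : ℕ∞)) ⁻¹' {0}) = {0} := by
    ext n
    simp
  rw [poissonLaw, if_neg ha, Measure.map_apply .of_discrete (measurableSet_singleton 0), h,
    poissonMeasure_singleton]
  simp [expNeg]
  rfl

/-! ### Avoidance probabilities and joint independence -/

namespace IsPoissonPointProcess

variable {Z : Type*} [TopologicalSpace Z] [MeasurableSpace Z] {lam : Measure Z} {t : ℝ≥0}
  {μ : Measure (Config Z)}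

theorem measure_avoid (hμ : IsPoissonPointProcess lam t μ) {U : Set Z} (hU : MeasurableSet U)
    (h : lam U ≠ ∞) : μ (Config.avoid U) = expNeg (t * lam U) := by
  rw [Config.avoid_eq_preimage_count, ← Measure.map_apply (Config.measurable_count hU)
    (measurableSet_singleton 0), hμ.poisson_counts U hU,
    poissonLaw_singleton_zero (ENNReal.mul_ne_top ENNReal.coe_ne_top h)]

theorem lintegral_pow_count (hμ : IsPoissonPointProcess lam t μ) {U : Set Z}
    (hU : MeasurableSet U) (h : lam U ≠ ∞) {c : ℝ≥0∞} (hc : c ≤ 1) :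
    ∫⁻ ω, c ^ (Config.count U ω).toNat ∂μ = expNeg (t * lam U * (1 - c)) := by
  rw [← lintegral_pow_poissonLaw (ENNReal.mul_ne_top ENNReal.coe_ne_top h) hc,
    ← hμ.poisson_counts U hU, lintegral_map .of_discrete (Config.measurable_count hU)]

variable [BorelSpace Z] [T2Space Z] [LocallyCompactSpace Z] [SecondCountableTopology Z]
  [IsFiniteMeasureOnCompacts lam]

/-- The counts of disjoint sets are jointly independent. -/
theorem iIndepFun_count (hμ : IsPoissonPointProcess lam t μ) {ι : Type*} {B : ι → Set Z}
    (hB : ∀ i, MeasurableSet (B i)) (hd : Pairwise (Function.onFun Disjoint B)) :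
    iIndepFun (fun i => Config.count (B i)) μ := by
  rw [iIndepFun_iff_iIndep]
  refine iIndep_of_iIndep_of_le
    (m₂ := fun i => MeasurableSpace.generateFrom (Config.avoidSets (B i))) ?_ fun i =>
    (Config.measurable_count_generateFrom_avoidSets (hB i)).comap_le
  refine iIndepSets.iIndep (fun i => Config.generateFrom_avoidSets_le _)
    (fun i => Config.avoidSets (B i)) (fun i => Config.isPiSystem_avoidSets _) (fun _ => rfl) ?_
  rw [iIndepSets_iff]
  intro s f hf
  have hf' : ∀ i, ∃ U : Set Z, i ∈ s → (MeasurableSet U ∧ U ⊆ B i ∧ lam U ≠ ∞) ∧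
      Config.avoid U = f i := by
    intro i
    by_cases hi : i ∈ s
    · obtain ⟨U, ⟨hU, hUB, K, hK, hUK⟩, h⟩ := hf i hi
      exact ⟨U, fun _ => ⟨⟨hU, hUB, ((measure_mono hUK).trans_lt hK.measure_lt_top).ne⟩, h⟩⟩
    · exact ⟨∅, fun h => absurd h hi⟩
  choose U hU using hf'
  -- Joint avoidance is avoidance of the union, so the product formula is additivity of `lam` on
  -- disjoint sets, passed through the exponential.
  have h1 : ⋂ i ∈ s, f i = Config.avoid (⋃ i ∈ s, U i) := by
    simp only [Config.avoid_iUnion]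
    exact iInter₂_congr fun i hi => (hU i hi).2.symm
  have hsum : lam (⋃ i ∈ s, U i) = ∑ i ∈ s, lam (U i) := by
    refine measure_biUnion_finset (fun i hi j hj hij => ?_) fun i hi => (hU i hi).1.1
    exact (hd hij).mono (hU i hi).1.2.1 (hU j hj).1.2.1
  have hfin : ∀ i ∈ s, lam (U i) ≠ ∞ := fun i hi => (hU i hi).1.2.2
  rw [h1, hμ.measure_avoid (Finset.measurableSet_biUnion s fun i hi => (hU i hi).1.1)
    (by rw [hsum]; exact ENNReal.sum_ne_top.2 hfin), hsum, Finset.mul_sum,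
    expNeg_sum _ _ fun i hi => ENNReal.mul_ne_top ENNReal.coe_ne_top (hfin i hi)]
  refine Finset.prod_congr rfl fun i hi => ?_
  rw [← (hU i hi).2, hμ.measure_avoid (hU i hi).1.1 (hfin i hi)]

end IsPoissonPointProcess

/-! ### The Laplace functional, in multiplicative form -/

namespace Config

variable {Z : Type*} [TopologicalSpace Z]

/-- The product of the values of `f` at the points of `ω` in the compact set `K`. -/
def prodOn {K : Set Z} (hK : IsCompact K) (f : Z → ℝ≥0∞) (ω : Config Z) : ℝ≥0∞ :=
  ∏ z ∈ (ω.2 K hK).toFinset, f z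

variable [MeasurableSpace Z]

/-- Group the points by the value of `f`; the counts are finite because `K` is compact. -/
theorem prodOn_simpleFunc {K : Set Z} (hK : IsCompact K) (f : SimpleFunc Z ℝ≥0∞) (ω : Config Z) :
    prodOn hK f ω = ∏ c ∈ f.range, c ^ (count (f ⁻¹' {c} ∩ K) ω).toNat := by
  classical
  rw [prodOn, ← Finset.prod_fiberwise_of_maps_to (g := f) fun z _ => f.mem_range_self z]
  refine Finset.prod_congr rfl fun c _ => ?_
  rw [Finset.prod_congr rfl fun z hz => (Finset.mem_filter.1 hz).2, Finset.prod_const]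
  congr 1
  have h : ω.1 ∩ (f ⁻¹' {c} ∩ K) = ({z ∈ (ω.2 K hK).toFinset | f z = c} : Finset Z) := by
    ext z
    simp
    tauto
  rw [count, h, encard_coe_eq_coe_finsetCard, ENat.toNat_natCast]

theorem tendsto_prodOn_eapprox {K : Set Z} (hK : IsCompact K) {f : Z → ℝ≥0∞} (hf : Measurable f)
    (hf1 : ∀ z, f z ≤ 1) (ω : Config Z) :
    Tendsto (fun n => prodOn hK (SimpleFunc.eapprox f n) ω) atTop (𝓝 (prodOn hK f ω)) :=
  ENNReal.tendsto_finsetProd_of_ne_top _ (fun z _ => SimpleFunc.tendsto_eapprox hf z)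
    fun z _ => ne_top_of_le_ne_top ENNReal.one_ne_top (hf1 z)

variable [BorelSpace Z] [T2Space Z]

theorem measurable_prodOn_simpleFunc {K : Set Z} (hK : IsCompact K) (f : SimpleFunc Z ℝ≥0∞) :
    Measurable (prodOn hK f) := by
  have h : prodOn hK f =
      fun ω => ∏ c ∈ f.range, c ^ (count (f ⁻¹' {c} ∩ K) ω).toNat :=
    funext (prodOn_simpleFunc hK f)
  rw [h]
  refine Finset.measurable_prod _ fun c _ => ?_
  exact (Measurable.of_discrete (f := fun n : ℕ∞ => c ^ n.toNat)).comp
    (measurable_count ((f.measurableSet_preimage _).inter hK.measurableSet))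

theorem measurable_prodOn {K : Set Z} (hK : IsCompact K) {f : Z → ℝ≥0∞} (hf : Measurable f)
    (hf1 : ∀ z, f z ≤ 1) : Measurable (prodOn hK f) :=
  measurable_of_tendsto_metrizable (fun _ => measurable_prodOn_simpleFunc hK _)
    (tendsto_pi_nhds.2 fun ω => tendsto_prodOn_eapprox hK hf hf1 ω)

end Config

namespace IsPoissonPointProcess

variable {Z : Type*} [TopologicalSpace Z] [MeasurableSpace Z] {lam : Measure Z} {t : ℝ≥0}
  {μ : Measure (Config Z)} [BorelSpace Z] [T2Space Z] [LocallyCompactSpace Z]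
  [SecondCountableTopology Z] [IsFiniteMeasureOnCompacts lam]

/-- The level sets of `f` in `K` have independent Poisson counts, so the integral is a product of
generating functions. -/
theorem lintegral_prodOn_simpleFunc (hμ : IsPoissonPointProcess lam t μ) {K : Set Z}
    (hK : IsCompact K) (f : SimpleFunc Z ℝ≥0∞) (hf1 : ∀ z, f z ≤ 1) :
    ∫⁻ ω, Config.prodOn hK f ω ∂μ = expNeg (t * ∫⁻ z in K, (1 - f z) ∂lam) := by
  have hind : iIndepFun (fun c : ℝ≥0∞ => Config.count (f ⁻¹' {c} ∩ K)) μ := by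
    refine hμ.iIndepFun_count (fun c => (f.measurableSet_preimage _).inter hK.measurableSet)
      fun c d hcd => ?_
    exact ((disjoint_singleton.2 hcd).preimage f).mono inter_subset_left inter_subset_left
  have hfin : ∀ c, lam (f ⁻¹' {c} ∩ K) ≠ ∞ := fun c =>
    ((measure_mono inter_subset_right).trans_lt hK.measure_lt_top).ne
  have hint : ∫⁻ z in K, (1 - f z) ∂lam = ∑ c ∈ f.range, (1 - c) * lam (f ⁻¹' {c} ∩ K) := by
    have h := SimpleFunc.map_lintegral (μ := lam.restrict K) (fun c : ℝ≥0∞ => 1 - c) f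
    rw [← SimpleFunc.lintegral_eq_lintegral] at h
    refine h.trans (Finset.sum_congr rfl fun c _ => ?_)
    rw [Measure.restrict_apply (f.measurableSet_preimage _)]
  simp only [Config.prodOn_simpleFunc]
  have h := lintegral_prod_eq_prod_lintegral_of_indepFun f.range
    (fun (c : ℝ≥0∞) ω => c ^ (Config.count (f ⁻¹' {c} ∩ K) ω).toNat)
    (hind.comp (fun (c : ℝ≥0∞) (n : ℕ∞) => c ^ n.toNat) fun c => .of_discrete)
    fun c => (Measurable.of_discrete (f := fun n : ℕ∞ => c ^ n.toNat)).comp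
      (Config.measurable_count ((f.measurableSet_preimage _).inter hK.measurableSet))
  rw [h, hint, Finset.mul_sum, expNeg_sum]
  · refine Finset.prod_congr rfl fun c hc => ?_
    obtain ⟨z, rfl⟩ := SimpleFunc.mem_range.1 hc
    rw [hμ.lintegral_pow_count ((f.measurableSet_preimage _).inter hK.measurableSet) (hfin _)
      (hf1 z)]
    congr 1
    ring
  · exact fun c _ => ENNReal.mul_ne_top ENNReal.coe_ne_top
      (ENNReal.mul_ne_top (ne_top_of_le_ne_top ENNReal.one_ne_top tsub_le_self) (hfin c))

/-- The Laplace functional of a Poisson point process. -/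
theorem lintegral_prodOn (hμ : IsPoissonPointProcess lam t μ) {K : Set Z}
    (hK : IsCompact K) {f : Z → ℝ≥0∞} (hf : Measurable f) (hf1 : ∀ z, f z ≤ 1) :
    ∫⁻ ω, Config.prodOn hK f ω ∂μ = expNeg (t * ∫⁻ z in K, (1 - f z) ∂lam) := by
  have hle : ∀ n z, SimpleFunc.eapprox f n z ≤ 1 := fun n z =>
    (le_iSup (fun n => SimpleFunc.eapprox f n z) n).trans
      ((SimpleFunc.iSup_eapprox_apply hf z).le.trans (hf1 z))
  have hK1 : ∫⁻ _ in K, 1 ∂lam ≠ ∞ := by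
    simpa using hK.measure_lt_top.ne
  have h1 : Tendsto (fun n => ∫⁻ ω, Config.prodOn hK (SimpleFunc.eapprox f n) ω ∂μ) atTop
      (𝓝 (∫⁻ ω, Config.prodOn hK f ω ∂μ)) := by
    refine lintegral_tendsto_of_tendsto_of_monotone
      (fun n => (Config.measurable_prodOn_simpleFunc hK _).aemeasurable)
      (Eventually.of_forall fun ω m n hmn => ?_)
      (Eventually.of_forall fun ω => Config.tendsto_prodOn_eapprox hK hf hf1 ω)
    exact Finset.prod_le_prod' fun z _ => SimpleFunc.monotone_eapprox f hmn z
  -- The integrands decrease here, so domination by `1` on `K` replaces the monotone convergence of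
  -- `h1`.
  have h2 : Tendsto (fun n => ∫⁻ z in K, (1 - SimpleFunc.eapprox f n z) ∂lam) atTop
      (𝓝 (∫⁻ z in K, (1 - f z) ∂lam)) := by
    refine tendsto_lintegral_of_dominated_convergence (fun _ => 1)
      (fun n => measurable_const.sub (SimpleFunc.measurable _))
      (fun n => Eventually.of_forall fun z => tsub_le_self) hK1
      (Eventually.of_forall fun z => ?_)
    exact ENNReal.Tendsto.sub tendsto_const_nhds (SimpleFunc.tendsto_eapprox hf z)
      (Or.inl ENNReal.one_ne_top)
  have hne : ∫⁻ z in K, (1 - f z) ∂lam ≠ ∞ :=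
    ne_top_of_le_ne_top hK1 (lintegral_mono fun z => tsub_le_self)
  refine tendsto_nhds_unique h1 ?_
  simp only [fun n => hμ.lintegral_prodOn_simpleFunc hK (SimpleFunc.eapprox f n) (hle n)]
  exact (tendsto_expNeg (ENNReal.mul_ne_top ENNReal.coe_ne_top hne)).comp
    (ENNReal.Tendsto.const_mul h2 (Or.inr ENNReal.coe_ne_top))

end IsPoissonPointProcess

/-! ### Avoidance events for marked configurations -/

namespace MarkedConfig

variable {G : Type*} [TopologicalSpace G]

/-- The marked configurations without points in `V`. -/
def avoid (V : Set (G × I)) : Set (MarkedConfig G) := Subtype.val ⁻¹' Config.avoid V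

theorem mem_avoid {V : Set (G × I)} {ω : MarkedConfig G} :
    ω ∈ avoid V ↔ ∀ p ∈ ω.1.1, p ∉ V := Set.disjoint_left

theorem avoid_empty : avoid (∅ : Set (G × I)) = univ := by
  rw [avoid, Config.avoid_empty, preimage_univ]

theorem avoid_union (U V : Set (G × I)) : avoid (U ∪ V) = avoid U ∩ avoid V := by
  rw [avoid, Config.avoid_union, preimage_inter]
  rfl

theorem avoid_iUnion {ι : Sort*} (V : ι → Set (G × I)) : avoid (⋃ i, V i) = ⋂ i, avoid (V i) := by
  rw [avoid, Config.avoid_iUnion, preimage_iInter]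
  rfl

variable [MeasurableSpace G]

/-- The events `avoid V`, for relatively compact Borel sets `V`. -/
def avoidSets : Set (Set (MarkedConfig G)) :=
  avoid '' {V | MeasurableSet V ∧ ∃ K, IsCompact K ∧ V ⊆ K}

theorem isPiSystem_avoidSets : IsPiSystem (avoidSets (G := G)) := by
  rintro _ ⟨U, ⟨hU, K, hK, hUK⟩, rfl⟩ _ ⟨V, ⟨hV, L, hL, hVL⟩, rfl⟩ -
  exact ⟨U ∪ V, ⟨hU.union hV, K ∪ L, hK.union hL, union_subset_union hUK hVL⟩, avoid_union U V⟩

theorem univ_mem_avoidSets : univ ∈ avoidSets (G := G) :=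
  ⟨∅, ⟨MeasurableSet.empty, ∅, isCompact_empty, subset_rfl⟩, avoid_empty⟩

theorem measurableSet_avoid {V : Set (G × I)} (hV : MeasurableSet V) : MeasurableSet (avoid V) :=
  (Config.measurableSet_avoid hV).preimage measurable_subtype_coe

variable [BorelSpace G] [T2Space G] [LocallyCompactSpace G] [SecondCountableTopology G]

theorem eq_generateFrom_avoidSets :
    (inferInstance : MeasurableSpace (MarkedConfig G)) =
      MeasurableSpace.generateFrom avoidSets := by
  have h : preimage Subtype.val '' Config.avoidSets (univ : Set (G × I)) =
      (avoidSets : Set (Set (MarkedConfig G))) := by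
    rw [Config.avoidSets, image_image, avoidSets]
    simp only [subset_univ, true_and]
    rfl
  change MeasurableSpace.comap Subtype.val inferInstance = _
  rw [Config.generateFrom_avoidSets_univ, MeasurableSpace.comap_generateFrom, h]

theorem measurable_of_avoid {α : Type*} [MeasurableSpace α] {f : α → MarkedConfig G}
    (hf : ∀ V : Set (G × I), MeasurableSet V → MeasurableSet (f ⁻¹' avoid V)) : Measurable f := by
  rw [measurable_iff_comap_le]
  rw [show (Subtype.instMeasurableSpace : MeasurableSpace (MarkedConfig G)) =
    MeasurableSpace.generateFrom avoidSets from eq_generateFrom_avoidSets,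
    MeasurableSpace.comap_generateFrom]
  refine MeasurableSpace.generateFrom_le ?_
  rintro _ ⟨_, ⟨V, hV, rfl⟩, rfl⟩
  exact hf V hV.1

/-- Rényi's theorem: the law of a random marked configuration is determined by its avoidance
probabilities. -/
theorem ext_of_avoid {ν ν' : Measure (MarkedConfig G)} [IsFiniteMeasure ν]
    (h : ∀ V : Set (G × I), MeasurableSet V → (∃ K, IsCompact K ∧ V ⊆ K) →
      ν (avoid V) = ν' (avoid V)) : ν = ν' := by
  refine ext_of_generate_finite avoidSets eq_generateFrom_avoidSets isPiSystem_avoidSets ?_ ?_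
  · rintro _ ⟨V, hV, rfl⟩
    exact h V hV.1 hV.2
  · rw [← avoid_empty]
    exact h ∅ MeasurableSet.empty ⟨∅, isCompact_empty, subset_rfl⟩

end MarkedConfig

/-! ### Random labels and the marking theorem -/

namespace Config

variable {G : Type*} [TopologicalSpace G]

theorem label_mem_avoid {ω : Config G} {u : ω.1 → I} {V : Set (G × I)} :
    ω.label u ∈ MarkedConfig.avoid V ↔ ∀ g : ω.1, ((g : G), u g) ∉ V := by
  rw [MarkedConfig.mem_avoid]
  exact forall_mem_range

theorem countable_coe [SigmaCompactSpace G] (ω : Config G) : ω.1.Countable := by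
  rw [← inter_univ ω.1, ← iUnion_compactCovering, inter_iUnion]
  exact countable_iUnion fun n => (ω.2 _ (isCompact_compactCovering G n)).countable

variable [MeasurableSpace G] [BorelSpace G] [T2Space G] [LocallyCompactSpace G]
  [SecondCountableTopology G]

theorem measurable_label (ω : Config G) : Measurable ω.label := by
  refine MarkedConfig.measurable_of_avoid fun V hV => ?_
  have : Countable ω.1 := ω.countable_coe.to_subtype
  have h : ω.label ⁻¹' MarkedConfig.avoid V = ⋂ g : ω.1, {u | ((g : G), u g) ∉ V} := by
    ext u
    simp only [mem_preimage, label_mem_avoid, mem_iInter, mem_ofPred_eq]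
  rw [h]
  refine MeasurableSet.iInter fun g => ?_
  exact hV.compl.preimage (f := fun u : ω.1 → I => ((g : G), u g))
    (measurable_const.prodMk (measurable_pi_apply g))

instance (ω : Config G) : IsProbabilityMeasure ω.labelLaw :=
  Measure.isProbabilityMeasure_map ω.measurable_label.aemeasurable

/-- Only the finitely many points of `ω` in `K` can acquire a mark that puts them in `V`, so the
event is a finite-dimensional box for the product measure. -/
theorem labelLaw_avoid (ω : Config G) {V : Set (G × I)} (hV : MeasurableSet V) {K : Set G}
    (hK : IsCompact K) (hVK : V ⊆ Prod.fst ⁻¹' K) :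
    ω.labelLaw (MarkedConfig.avoid V) =
      prodOn hK (fun g => volume (Prod.mk g ⁻¹' Vᶜ)) ω := by
  classical
  have h : ω.label ⁻¹' MarkedConfig.avoid V =
      Set.pi ((ω.2 K hK).toFinset.subtype (· ∈ ω.1) : Finset ω.1)
        (fun g : ω.1 => Prod.mk (g : G) ⁻¹' Vᶜ) := by
    ext u
    simp only [mem_preimage, label_mem_avoid, Set.mem_pi, mem_compl_iff, Finset.mem_coe,
      Finset.mem_subtype, Finite.mem_toFinset, mem_inter_iff]
    exact ⟨fun h g _ => h g, fun h g hg => h g ⟨g.2, hVK hg⟩ hg⟩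
  rw [labelLaw, Measure.map_apply ω.measurable_label (MarkedConfig.measurableSet_avoid hV), h,
    Measure.infinitePi_pi _ fun g _ => hV.compl.preimage measurable_prodMk_left]
  exact Finset.prod_subtype_of_mem (fun g => (volume (Prod.mk g ⁻¹' Vᶜ) : ℝ≥0∞))
    fun g hg => ((ω.2 K hK).mem_toFinset.1 hg).1

/-- Makes `iidLaw` a genuine mixture: `Measure.bind` is then computed by integrating `labelLaw`. -/
theorem measurable_labelLaw : Measurable (labelLaw : Config G → Measure (MarkedConfig G)) := by
  refine Measurable.measure_of_isPiSystem_of_isProbabilityMeasure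
    MarkedConfig.eq_generateFrom_avoidSets MarkedConfig.isPiSystem_avoidSets ?_
  rintro _ ⟨V, ⟨hV, L, hL, hVL⟩, rfl⟩
  have hVK : V ⊆ Prod.fst ⁻¹' (Prod.fst '' L) := hVL.trans (subset_preimage_image _ _)
  simp only [fun ω : Config G => labelLaw_avoid ω hV (hL.image continuous_fst) hVK]
  exact measurable_prodOn _ (measurable_measure_prodMk_left hV.compl) fun _ => prob_le_one

end Config

section

variable {G : Type*} [TopologicalSpace G] [MeasurableSpace G] [BorelSpace G] [T2Space G]
  [LocallyCompactSpace G] [SecondCountableTopology G] (μ : Measure (Config G))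

instance isProbabilityMeasure_iidLaw [IsProbabilityMeasure μ] :
    IsProbabilityMeasure (iidLaw μ) where
  measure_univ := by
    rw [iidLaw, Measure.bind_apply MeasurableSet.univ Config.measurable_labelLaw.aemeasurable]
    simp

namespace IsPoissonPointProcess

variable {μ} {lam : Measure G} {t : ℝ≥0} [IsFiniteMeasureOnCompacts lam]

/-- The marking theorem: the IID version of a Poisson point process has the avoidance probabilities of a
Poisson point process on `G × [0,1]`. -/
theorem iidLaw_avoid (hμ : IsPoissonPointProcess lam t μ) {V : Set (G × I)} (hV : MeasurableSet V)
    {L : Set (G × I)} (hL : IsCompact L) (hVL : V ⊆ L) :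
    iidLaw μ (MarkedConfig.avoid V) = expNeg (t * lam.prod volume V) := by
  have hVK : V ⊆ Prod.fst ⁻¹' (Prod.fst '' L) := hVL.trans (subset_preimage_image _ _)
  have hK : IsCompact (Prod.fst '' L) := hL.image continuous_fst
  rw [iidLaw, Measure.bind_apply (MarkedConfig.measurableSet_avoid hV)
    Config.measurable_labelLaw.aemeasurable]
  simp only [fun ω : Config G => Config.labelLaw_avoid ω hV hK hVK]
  rw [hμ.lintegral_prodOn hK (measurable_measure_prodMk_left hV.compl) fun _ => prob_le_one,
    Measure.prod_apply hV]
  congr 2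
  have h : ∀ g, 1 - (volume (Prod.mk g ⁻¹' Vᶜ) : ℝ≥0∞) = volume (Prod.mk g ⁻¹' V) := by
    intro g
    have hm : MeasurableSet (Prod.mk g ⁻¹' V) := hV.preimage measurable_prodMk_left
    rw [preimage_compl, ← prob_compl_eq_one_sub hm.compl, compl_compl]
  simp only [h]
  -- The integral over the projection of `L` equals the integral over `G`, since the fibres of `V`
  -- elsewhere are empty.
  refine setLIntegral_eq_of_support_subset fun g hg => ?_
  by_contra hgK
  refine hg ?_
  have h0 : Prod.mk g ⁻¹' V = (∅ : Set I) := eq_empty_of_forall_notMem fun x hx => hgK (hVK hx)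
  simp only [h0, measure_empty]

variable [IsProbabilityMeasure μ]

theorem iidLaw_compl_avoid_le (hμ : IsPoissonPointProcess lam t μ) {V : Set (G × I)}
    (hV : MeasurableSet V) {L : Set (G × I)} (hL : IsCompact L) (hVL : V ⊆ L) :
    iidLaw μ (MarkedConfig.avoid V)ᶜ ≤ t * lam.prod volume V := by
  rw [prob_compl_eq_one_sub (MarkedConfig.measurableSet_avoid hV), hμ.iidLaw_avoid hV hL hVL]
  exact one_sub_expNeg_le _

/-- No compactness of `V` is needed: exhaust `V` by countably many relatively compact pieces. -/
theorem iidLaw_compl_avoid_eq_zero (hμ : IsPoissonPointProcess lam t μ) {V : Set (G × I)}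
    (hV : MeasurableSet V) (h0 : lam.prod volume V = 0) :
    iidLaw μ (MarkedConfig.avoid V)ᶜ = 0 := by
  have h : V = ⋃ n, V ∩ compactCovering (G × I) n := by
    rw [← inter_iUnion, iUnion_compactCovering, inter_univ]
  rw [h, MarkedConfig.avoid_iUnion, compl_iInter, measure_iUnion_null_iff]
  intro n
  have hn := hμ.iidLaw_compl_avoid_le (hV.inter (isCompact_compactCovering (G × I) n).measurableSet)
    (isCompact_compactCovering (G × I) n) inter_subset_right
  rw [measure_mono_null inter_subset_left h0, mul_zero] at hn
  exact le_antisymm hn zero_le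

end IsPoissonPointProcess

end

/-! ### Pairs of configurations with disjoint supports -/

namespace MarkedConfig

section Support

variable {G : Type*} [TopologicalSpace G]

/-- The configuration on `G` underlying a marked configuration. -/
def support (ω : MarkedConfig G) : Set G := Prod.fst '' ω.1.1

theorem finite_support_inter (ω : MarkedConfig G) {K : Set G} (hK : IsCompact K) :
    (ω.support ∩ K).Finite := by
  refine ((ω.1.2 (K ×ˢ univ) (hK.prod isCompact_univ)).image Prod.fst).subset ?_
  rintro _ ⟨⟨p, hp, rfl⟩, hpK⟩
  exact ⟨p, ⟨hp, hpK, mem_univ _⟩, rfl⟩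

theorem mem_avoid_preimage_fst {W : Set G} {ω : MarkedConfig G} :
    ω ∈ avoid (Prod.fst ⁻¹' W) ↔ Disjoint ω.support W := by
  rw [mem_avoid, Set.disjoint_left]
  exact ⟨by rintro h _ ⟨q, hq, rfl⟩; exact h q hq, fun h q hq => h ⟨q, hq, rfl⟩⟩

theorem countable_support [SigmaCompactSpace G] (ω : MarkedConfig G) : ω.support.Countable := by
  rw [← inter_univ ω.support, ← iUnion_compactCovering, inter_iUnion]
  exact countable_iUnion fun n =>
    (ω.finite_support_inter (isCompact_compactCovering G n)).countable

variable (G) in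
/-- The pairs of marked configurations without a common point of `G`. -/
def disjointPairs : Set (MarkedConfig G × MarkedConfig G) :=
  {p | Disjoint p.1.support p.2.support}

theorem swap_mem_disjointPairs {p : MarkedConfig G × MarkedConfig G} (hp : p ∈ disjointPairs G) :
    p.swap ∈ disjointPairs G := Disjoint.symm hp

theorem notMem_of_mem_disjointPairs {p : MarkedConfig G × MarkedConfig G}
    (hp : p ∈ disjointPairs G) {g : G} {x y : I} (hx : (g, x) ∈ p.1.1.1) : (g, y) ∉ p.2.1.1 :=
  fun hy => Set.disjoint_left.1 hp ⟨_, hx, rfl⟩ ⟨_, hy, rfl⟩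

/-- Two locally finite sets are disjoint if and only if, on each of the compact sets of a covering, they
are separated by a finite union of basic open sets. -/
theorem mem_disjointPairs_iff [T2Space G] [LocallyCompactSpace G] [SecondCountableTopology G]
    {p : MarkedConfig G × MarkedConfig G} :
    p ∈ disjointPairs G ↔ ∀ n, ∃ s : Finset (countableBasis G),
      p.1 ∈ avoid (Prod.fst ⁻¹' (compactCovering G n \ ⋃ v ∈ s, (v : Set G))) ∧
      p.2 ∈ avoid (Prod.fst ⁻¹' (compactCovering G n ∩ ⋃ v ∈ s, (v : Set G))) := by
  classical
  simp only [mem_avoid_preimage_fst]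
  constructor
  · intro hp n
    have hK := isCompact_compactCovering G n
    have h1 := p.1.finite_support_inter hK
    have h2 := p.2.finite_support_inter hK
    have hv : ∀ g, ∃ v : countableBasis G, g ∈ p.1.support →
        g ∈ (v : Set G) ∧ (v : Set G) ⊆ (p.2.support ∩ compactCovering G n)ᶜ := by
      intro g
      by_cases hg : g ∈ p.1.support
      · have hg' : g ∈ (p.2.support ∩ compactCovering G n)ᶜ := fun h =>
          Set.disjoint_left.1 hp hg h.1
        obtain ⟨v, hv, hgv, hvs⟩ := (isBasis_countableBasis G).exists_subset_of_mem_open hg'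
          h2.isClosed.isOpen_compl
        exact ⟨⟨v, hv⟩, fun _ => ⟨hgv, hvs⟩⟩
      · obtain ⟨v, hv, -⟩ := (isBasis_countableBasis G).exists_subset_of_mem_open
          (mem_univ g) isOpen_univ
        exact ⟨⟨v, hv⟩, fun h => absurd h hg⟩
    choose v hv using hv
    refine ⟨h1.toFinset.image v, Set.disjoint_left.2 fun g hg hgK => hgK.2 ?_,
      Set.disjoint_left.2 fun g hg hgK => ?_⟩
    · exact mem_biUnion (Finset.mem_coe.2 (Finset.mem_image_of_mem v
        (h1.mem_toFinset.2 ⟨hg, hgK.1⟩))) (hv g hg).1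
    · obtain ⟨w, hw, hgw⟩ := mem_iUnion₂.1 hgK.2
      obtain ⟨a, ha, rfl⟩ := Finset.mem_image.1 hw
      exact (hv a (h1.mem_toFinset.1 ha).1).2 hgw ⟨hg, hgK.1⟩
  · intro h
    refine Set.disjoint_left.2 fun g hg1 hg2 => ?_
    obtain ⟨n, hn⟩ := iUnion_eq_univ_iff.1 (iUnion_compactCovering G) g
    obtain ⟨s, hs1, hs2⟩ := h n
    refine Set.disjoint_left.1 hs1 hg1 ⟨hn, fun hgs => ?_⟩
    exact Set.disjoint_left.1 hs2 hg2 ⟨hn, hgs⟩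

theorem measurableSet_disjointPairs [T2Space G] [LocallyCompactSpace G]
    [SecondCountableTopology G] [MeasurableSpace G] [BorelSpace G] :
    MeasurableSet (disjointPairs G) := by
  have h : disjointPairs G = ⋂ n, ⋃ s : Finset (countableBasis G),
      avoid (Prod.fst ⁻¹' (compactCovering G n \ ⋃ v ∈ s, (v : Set G))) ×ˢ
      avoid (Prod.fst ⁻¹' (compactCovering G n ∩ ⋃ v ∈ s, (v : Set G))) := by
    ext p
    simp only [mem_disjointPairs_iff, mem_iInter, mem_iUnion, mem_prod]
  have : Countable (countableBasis G) := (countable_countableBasis G).to_subtype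
  rw [h]
  refine MeasurableSet.iInter fun n => MeasurableSet.iUnion fun s => ?_
  have hK := (isCompact_compactCovering G n).measurableSet
  have hs : MeasurableSet (⋃ v ∈ s, (v : Set G)) := Finset.measurableSet_biUnion s fun v _ =>
    (isOpen_of_mem_countableBasis v.2).measurableSet
  exact (measurableSet_avoid ((hK.diff hs).preimage measurable_fst)).prod
    (measurableSet_avoid ((hK.inter hs).preimage measurable_fst))

end Support

/-! ### The exchange map -/

section Exchange

variable {G : Type*} [TopologicalSpace G] (D : Set I)

/-- The points of `p.1` with marks outside `D`, together with the points of `p.2` with marks in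
`D`. -/
def mix (p : MarkedConfig G × MarkedConfig G) (hp : p ∈ disjointPairs G) : MarkedConfig G :=
  ⟨⟨{q | q ∈ p.1.1.1 ∧ q.2 ∉ D ∨ q ∈ p.2.1.1 ∧ q.2 ∈ D}, fun K hK => by
    refine ((p.1.1.2 K hK).union (p.2.1.2 K hK)).subset ?_
    rintro q ⟨h | h, hq⟩
    · exact Or.inl ⟨h.1, hq⟩
    · exact Or.inr ⟨h.1, hq⟩⟩, by
    rintro g x y (hx | hx) (hy | hy)
    · exact p.1.2 g x y hx.1 hy.1
    · exact absurd hy.1 (notMem_of_mem_disjointPairs hp hx.1)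
    · exact absurd hx.1 (notMem_of_mem_disjointPairs hp hy.1)
    · exact p.2.2 g x y hx.1 hy.1⟩

variable {D} in
theorem mem_mix {p : MarkedConfig G × MarkedConfig G} {hp : p ∈ disjointPairs G} {q : G × I} :
    q ∈ (mix D p hp).1.1 ↔ q ∈ p.1.1.1 ∧ q.2 ∉ D ∨ q ∈ p.2.1.1 ∧ q.2 ∈ D := Iff.rfl

/-- A common point of the two mixtures would come from a single original configuration and carry one
mark, which would lie both in `D` and outside it. -/
theorem mix_mem_disjointPairs {p : MarkedConfig G × MarkedConfig G} (hp : p ∈ disjointPairs G) :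
    (mix D p hp, mix D p.swap (swap_mem_disjointPairs hp)) ∈ disjointPairs G := by
  refine Set.disjoint_left.2 ?_
  rintro _ ⟨⟨g, x⟩, hx, rfl⟩ ⟨⟨g', y⟩, hy, hg⟩
  obtain rfl : g' = g := hg
  rcases hx with hx | hx <;> rcases hy with hy | hy
  · exact notMem_of_mem_disjointPairs hp hx.1 hy.1
  · obtain rfl := p.1.2 _ _ _ hx.1 hy.1
    exact hx.2 hy.2
  · obtain rfl := p.2.2 _ _ _ hx.1 hy.1
    exact hy.2 hx.2
  · exact notMem_of_mem_disjointPairs hp hy.1 hx.1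

open Classical in
/-- Exchange the points with marks in `D` between two disjoint marked configurations. -/
def exchange (p : MarkedConfig G × MarkedConfig G) : MarkedConfig G × MarkedConfig G :=
  if hp : p ∈ disjointPairs G then (mix D p hp, mix D p.swap (swap_mem_disjointPairs hp)) else p

theorem exchange_of_mem {p : MarkedConfig G × MarkedConfig G} (hp : p ∈ disjointPairs G) :
    exchange D p = (mix D p hp, mix D p.swap (swap_mem_disjointPairs hp)) := dif_pos hp

theorem exchange_of_notMem {p : MarkedConfig G × MarkedConfig G} (hp : p ∉ disjointPairs G) :
    exchange D p = p := dif_neg hp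

theorem mix_mix {p : MarkedConfig G × MarkedConfig G} (hp : p ∈ disjointPairs G)
    (hp' : (mix D p hp, mix D p.swap (swap_mem_disjointPairs hp)) ∈ disjointPairs G) :
    mix D (mix D p hp, mix D p.swap (swap_mem_disjointPairs hp)) hp' = p.1 := by
  apply Subtype.ext; apply Subtype.ext
  ext q
  rw [mem_mix]
  simp only [mem_mix, Prod.fst_swap, Prod.snd_swap]
  tauto

/-- Being the identity off `disjointPairs`, the exchange is a bijection everywhere, not merely
almost everywhere, as `MPEquiv` demands. -/
theorem exchange_involutive : Function.Involutive (exchange (G := G) D) := by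
  intro p
  by_cases hp : p ∈ disjointPairs G
  · rw [exchange_of_mem D hp, exchange_of_mem D (mix_mem_disjointPairs D hp)]
    refine Prod.ext (mix_mix D hp (mix_mem_disjointPairs D hp)) ?_
    exact mix_mix D (swap_mem_disjointPairs hp)
      (swap_mem_disjointPairs (mix_mem_disjointPairs D hp))
  · rw [exchange_of_notMem D hp, exchange_of_notMem D hp]

theorem exchange_empty (p : MarkedConfig G × MarkedConfig G) : exchange ∅ p = p := by
  by_cases hp : p ∈ disjointPairs G
  · rw [exchange_of_mem _ hp]
    refine Prod.ext ?_ ?_ <;> apply Subtype.ext <;> apply Subtype.ext <;> ext q <;> simp [mem_mix]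
  · exact exchange_of_notMem _ hp

theorem exchange_eq_swap {p : MarkedConfig G × MarkedConfig G} (hp : p ∈ disjointPairs G)
    (h1 : p.1 ∈ avoid (Prod.snd ⁻¹' Dᶜ)) (h2 : p.2 ∈ avoid (Prod.snd ⁻¹' Dᶜ)) :
    exchange D p = p.swap := by
  simp only [mem_avoid, mem_preimage, mem_compl_iff, not_not] at h1 h2
  rw [exchange_of_mem _ hp]
  refine Prod.ext ?_ ?_ <;> apply Subtype.ext <;> apply Subtype.ext <;> ext q <;> rw [mem_mix]
  · exact ⟨fun h => h.elim (fun h => absurd (h1 _ h.1) h.2) And.left, fun h => Or.inr ⟨h, h2 _ h⟩⟩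
  · exact ⟨fun h => h.elim (fun h => absurd (h2 _ h.1) h.2) And.left, fun h => Or.inr ⟨h, h1 _ h⟩⟩

theorem mix_mem_avoid {p : MarkedConfig G × MarkedConfig G} (hp : p ∈ disjointPairs G)
    {V : Set (G × I)} : mix D p hp ∈ avoid V ↔
      p.1 ∈ avoid (V \ Prod.snd ⁻¹' D) ∧ p.2 ∈ avoid (V ∩ Prod.snd ⁻¹' D) := by
  simp only [mem_avoid, mem_mix, Set.mem_sdiff, mem_inter_iff, mem_preimage]
  exact ⟨fun h => ⟨fun q hq hqV => h q (Or.inl ⟨hq, hqV.2⟩) hqV.1,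
    fun q hq hqV => h q (Or.inr ⟨hq, hqV.2⟩) hqV.1⟩,
    fun h q hq hqV => hq.elim (fun hq => h.1 q hq.1 ⟨hqV, hq.2⟩)
      fun hq => h.2 q hq.1 ⟨hqV, hq.2⟩⟩

/-- Rectangles of avoidance events pull back to rectangles of the same kind; measurability,
invariance of the measure and continuity all rest on this. -/
theorem exchange_mem_avoid_prod {p : MarkedConfig G × MarkedConfig G} (hp : p ∈ disjointPairs G)
    {U V : Set (G × I)} : exchange D p ∈ avoid U ×ˢ avoid V ↔
      p ∈ avoid (U \ Prod.snd ⁻¹' D ∪ V ∩ Prod.snd ⁻¹' D) ×ˢ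
        avoid (V \ Prod.snd ⁻¹' D ∪ U ∩ Prod.snd ⁻¹' D) := by
  rw [exchange_of_mem D hp, mem_prod, mix_mem_avoid, mix_mem_avoid, mem_prod, avoid_union,
    avoid_union, mem_inter_iff, mem_inter_iff, Prod.fst_swap, Prod.snd_swap]
  tauto

section Measurable

variable [MeasurableSpace G] [BorelSpace G] [T2Space G] [LocallyCompactSpace G]
  [SecondCountableTopology G] {D}

theorem measurable_exchange (hD : MeasurableSet D) : Measurable (exchange (G := G) D) := by
  have hD' : MeasurableSet (Prod.snd ⁻¹' D : Set (G × I)) := hD.preimage measurable_snd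
  have key : ∀ U V : Set (G × I), MeasurableSet U → MeasurableSet V →
      MeasurableSet (exchange D ⁻¹' (avoid U ×ˢ avoid V)) := by
    intro U V hU hV
    have h : exchange D ⁻¹' (avoid U ×ˢ avoid V) =
        (disjointPairs G).ite (avoid (U \ Prod.snd ⁻¹' D ∪ V ∩ Prod.snd ⁻¹' D) ×ˢ
          avoid (V \ Prod.snd ⁻¹' D ∪ U ∩ Prod.snd ⁻¹' D)) (avoid U ×ˢ avoid V) := by
      ext p
      by_cases hp : p ∈ disjointPairs G
      · rw [mem_preimage, exchange_mem_avoid_prod D hp]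
        simp only [Set.ite, mem_union, mem_inter_iff, Set.mem_sdiff, hp, and_true, not_true_eq_false,
          and_false, or_false]
      · rw [mem_preimage, exchange_of_notMem D hp]
        simp only [Set.ite, mem_union, mem_inter_iff, Set.mem_sdiff, hp, and_false,
          not_false_eq_true, and_true, false_or]
    rw [h]
    exact measurableSet_disjointPairs.ite
      ((measurableSet_avoid ((hU.diff hD').union (hV.inter hD'))).prod
        (measurableSet_avoid ((hV.diff hD').union (hU.inter hD'))))
      ((measurableSet_avoid hU).prod (measurableSet_avoid hV))
  refine Measurable.prodMk (f := fun p => (exchange D p).1) (g := fun p => (exchange D p).2)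
    (measurable_of_avoid fun U hU => ?_) (measurable_of_avoid fun V hV => ?_)
  -- Avoiding `∅` is no condition, so a rectangle with an empty side describes a single coordinate.
  · have h := key U ∅ hU MeasurableSet.empty
    rwa [avoid_empty, prod_univ] at h
  · have h := key ∅ V MeasurableSet.empty hV
    rwa [avoid_empty, univ_prod] at h

/-- The exchange of the points with marks in `D`, as a measurable automorphism. -/
def exchangeEquiv (hD : MeasurableSet D) :
    MarkedConfig G × MarkedConfig G ≃ᵐ MarkedConfig G × MarkedConfig G where
  toEquiv := (exchange_involutive D).toPerm
  measurable_toFun := measurable_exchange hD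
  measurable_invFun := measurable_exchange hD

theorem image_exchangeEquiv (hD : MeasurableSet D) (A : Set (MarkedConfig G × MarkedConfig G)) :
    exchangeEquiv hD '' A = exchange D ⁻¹' A :=
  congrFun (Function.Involutive.image_eq_preimage_symm (exchange_involutive D)) A

end Measurable

end Exchange

/-! ### Equivariance of the exchange -/

section Action

variable {G : Type*} [Group G] [TopologicalSpace G] [IsTopologicalGroup G]

theorem mem_smul_iff {g h : G} {x : I} {ω : MarkedConfig G} :
    (h, x) ∈ (g • ω).1.1 ↔ (g⁻¹ * h, x) ∈ ω.1.1 := by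
  rw [coe_smul]
  constructor
  · rintro ⟨⟨a, y⟩, ha, h⟩
    obtain ⟨rfl, rfl⟩ := Prod.mk.inj h
    simpa using ha
  · intro ha
    exact ⟨_, ha, by simp⟩

theorem smul_mem_disjointPairs {g : G} {p : MarkedConfig G × MarkedConfig G}
    (hp : p ∈ disjointPairs G) : g • p ∈ disjointPairs G := by
  refine Set.disjoint_left.2 ?_
  rintro _ ⟨⟨h, x⟩, hx, rfl⟩ ⟨⟨h', y⟩, hy, hh⟩
  obtain rfl : h' = h := hh
  exact notMem_of_mem_disjointPairs hp (mem_smul_iff.1 hx) (mem_smul_iff.1 hy)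

theorem mix_smul (D : Set I) {g : G} {p : MarkedConfig G × MarkedConfig G}
    (hp : p ∈ disjointPairs G) : mix D (g • p) (smul_mem_disjointPairs hp) = g • mix D p hp := by
  apply Subtype.ext; apply Subtype.ext
  ext ⟨h, x⟩
  rw [mem_smul_iff (ω := mix D p hp)]
  exact or_congr (and_congr_left' mem_smul_iff) (and_congr_left' mem_smul_iff)

/-- Translation keeps marks and preserves `disjointPairs` in both directions, so the identity holds
at every `p`. -/
theorem exchange_smul (D : Set I) (g : G) (p : MarkedConfig G × MarkedConfig G) :
    exchange D (g • p) = g • exchange D p := by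
  by_cases hp : p ∈ disjointPairs G
  · rw [exchange_of_mem D hp, exchange_of_mem D (smul_mem_disjointPairs hp)]
    exact Prod.ext (mix_smul D hp) (mix_smul D (swap_mem_disjointPairs hp))
  · have hp' : g • p ∉ disjointPairs G := fun h => hp (by
      simpa using smul_mem_disjointPairs (g := g⁻¹) h)
    rw [exchange_of_notMem D hp, exchange_of_notMem D hp']

theorem smul_mem_avoid {g : G} {ω : MarkedConfig G} {V : Set (G × I)} :
    g • ω ∈ avoid V ↔ ω ∈ avoid (shift g ⁻¹' V) := by
  rw [mem_avoid, mem_avoid, coe_smul, forall_mem_image]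
  rfl

end Action

end MarkedConfig

/-! ### Comparison of exchanges for different mark sets -/

open scoped symmDiff

theorem volume_symmDiff_Iio_le (r s : I) : volume (Iio s ∆ Iio r) ≤ edist s r := by
  have h : Iio s ∆ Iio r ⊆ uIcc r s := by
    rintro x (⟨hx, hx'⟩ | ⟨hx, hx'⟩)
    · exact mem_uIcc.2 (Or.inl ⟨not_lt.1 hx', le_of_lt hx⟩)
    · exact mem_uIcc.2 (Or.inr ⟨not_lt.1 hx', le_of_lt hx⟩)
  exact (measure_mono h).trans (unitInterval.volume_uIcc r s).le

namespace MarkedConfig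

variable {G : Type*} [TopologicalSpace G]

/-- If neither configuration has a point in `L` with mark in `D ∆ E`, the two exchanges look the
same inside `L`. -/
theorem symmDiff_preimage_exchange_subset {U V L : Set (G × I)} (hU : U ⊆ L) (hV : V ⊆ L)
    (D E : Set I) :
    (exchange D ⁻¹' (avoid U ×ˢ avoid V)) ∆ (exchange E ⁻¹' (avoid U ×ˢ avoid V)) ⊆
      Prod.fst ⁻¹' (avoid (L ∩ Prod.snd ⁻¹' (D ∆ E)))ᶜ ∪
        Prod.snd ⁻¹' (avoid (L ∩ Prod.snd ⁻¹' (D ∆ E)))ᶜ := by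
  intro p hp
  by_contra hN
  rw [mem_union, not_or, mem_preimage, mem_preimage, notMem_compl_iff, notMem_compl_iff,
    mem_avoid, mem_avoid] at hN
  have hD : ∀ x, x ∉ D ∆ E → (x ∈ D ↔ x ∈ E) := fun x hx => by
    rw [Set.mem_symmDiff] at hx
    tauto
  have key : ∀ ω : MarkedConfig G, (∀ q ∈ ω.1.1, q ∉ L ∩ Prod.snd ⁻¹' (D ∆ E)) →
      ∀ A B, A ⊆ L → B ⊆ L → (ω ∈ avoid (A \ Prod.snd ⁻¹' D ∪ B ∩ Prod.snd ⁻¹' D) ↔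
        ω ∈ avoid (A \ Prod.snd ⁻¹' E ∪ B ∩ Prod.snd ⁻¹' E)) := by
    intro ω hω A B hA hB
    rw [mem_avoid, mem_avoid]
    refine forall₂_congr fun q hq => ?_
    by_cases hqL : q ∈ L
    · have h := hD q.2 fun h => hω q hq ⟨hqL, h⟩
      simp only [mem_union, Set.mem_sdiff, mem_inter_iff, mem_preimage, h]
    · have hqA : q ∉ A := fun h => hqL (hA h)
      have hqB : q ∉ B := fun h => hqL (hB h)
      simp only [mem_union, Set.mem_sdiff, mem_inter_iff, hqA, hqB, false_and]
  have hiff : exchange D p ∈ avoid U ×ˢ avoid V ↔ exchange E p ∈ avoid U ×ˢ avoid V := by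
    by_cases hpd : p ∈ disjointPairs G
    · rw [exchange_mem_avoid_prod D hpd, exchange_mem_avoid_prod E hpd, mem_prod, mem_prod,
        key _ hN.1 U V hU hV, key _ hN.2 V U hV hU]
    · rw [exchange_of_notMem D hpd, exchange_of_notMem E hpd]
  rw [Set.mem_symmDiff, mem_preimage, mem_preimage, hiff] at hp
  tauto

variable [MeasurableSpace G] [BorelSpace G] [T2Space G]
  [LocallyCompactSpace G] [SecondCountableTopology G]

theorem prod_ext_of_avoid {ν : Measure (MarkedConfig G)} [IsFiniteMeasure ν]
    {ρ : Measure (MarkedConfig G × MarkedConfig G)}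
    (h : ∀ U V : Set (G × I), MeasurableSet U → (∃ K, IsCompact K ∧ U ⊆ K) → MeasurableSet V →
      (∃ K, IsCompact K ∧ V ⊆ K) → ρ (avoid U ×ˢ avoid V) = ν (avoid U) * ν (avoid V)) :
    ν.prod ν = ρ := by
  have hs : ν.FiniteSpanningSetsIn (avoidSets (G := G)) :=
    ⟨fun _ => univ, fun _ => univ_mem_avoidSets, fun _ => measure_lt_top _ _, iUnion_const _⟩
  refine Measure.prod_eq_generateFrom eq_generateFrom_avoidSets.symm
    eq_generateFrom_avoidSets.symm isPiSystem_avoidSets isPiSystem_avoidSets hs hs ?_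
  rintro _ ⟨U, ⟨hU, hUK⟩, rfl⟩ _ ⟨V, ⟨hV, hVK⟩, rfl⟩
  exact h U V hU hUK hV hVK

end MarkedConfig

/-! ### The exchange path in the automorphism group -/

namespace IsPoissonPointProcess

open MarkedConfig

section Exchange

variable {G : Type*} [TopologicalSpace G] [MeasurableSpace G] [BorelSpace G] [T2Space G]
  [LocallyCompactSpace G] [SecondCountableTopology G] {μ : Measure (Config G)}
  {lam : Measure G} {t : ℝ≥0} [IsFiniteMeasureOnCompacts lam]

/-- Both sides are exponentials, and swapping the parts over `D` leaves the sum of the two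
intensities unchanged. -/
theorem iidLaw_avoid_mul (hμ : IsPoissonPointProcess lam t μ) {D : Set I} (hD : MeasurableSet D)
    {U V : Set (G × I)} (hU : MeasurableSet U) (hV : MeasurableSet V)
    (hUK : ∃ K, IsCompact K ∧ U ⊆ K) (hVK : ∃ K, IsCompact K ∧ V ⊆ K) :
    iidLaw μ (avoid (U \ Prod.snd ⁻¹' D ∪ V ∩ Prod.snd ⁻¹' D)) *
      iidLaw μ (avoid (V \ Prod.snd ⁻¹' D ∪ U ∩ Prod.snd ⁻¹' D)) =
    iidLaw μ (avoid U) * iidLaw μ (avoid V) := by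
  obtain ⟨K, hK, hUK⟩ := hUK
  obtain ⟨L, hL, hVL⟩ := hVK
  have hD' : MeasurableSet (Prod.snd ⁻¹' D : Set (G × I)) := hD.preimage measurable_snd
  set D' : Set (G × I) := Prod.snd ⁻¹' D
  have hfin : ∀ W ⊆ K ∪ L, t * lam.prod volume W ≠ ∞ := fun W hW =>
    ENNReal.mul_ne_top ENNReal.coe_ne_top
      ((measure_mono hW).trans_lt (hK.union hL).measure_lt_top).ne
  have hU' : U ⊆ K ∪ L := hUK.trans subset_union_left
  have hV' : V ⊆ K ∪ L := hVL.trans subset_union_right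
  have h1 : U \ D' ∪ V ∩ D' ⊆ K ∪ L :=
    union_subset (Set.sdiff_subset.trans hU') (inter_subset_left.trans hV')
  have h2 : V \ D' ∪ U ∩ D' ⊆ K ∪ L :=
    union_subset (Set.sdiff_subset.trans hV') (inter_subset_left.trans hU')
  have hm1 := (hU.diff hD').union (hV.inter hD')
  have hm2 := (hV.diff hD').union (hU.inter hD')
  rw [hμ.iidLaw_avoid hm1 (hK.union hL) h1, hμ.iidLaw_avoid hm2 (hK.union hL) h2,
    hμ.iidLaw_avoid hU hK hUK, hμ.iidLaw_avoid hV hL hVL,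
    ← expNeg_add (hfin _ h1) (hfin _ h2), ← expNeg_add (hfin _ hU') (hfin _ hV'),
    measure_union (disjoint_sdiff_left.mono_right inter_subset_right) (hV.inter hD'),
    measure_union (disjoint_sdiff_left.mono_right inter_subset_right) (hU.inter hD'),
    ← measure_inter_add_sdiff U hD', ← measure_inter_add_sdiff V hD']
  congr 1
  ring

variable [IsProbabilityMeasure μ]

/-- Two independent Poisson point processes with nonatomic intensity are disjoint. -/
theorem ae_mem_disjointPairs (hμ : IsPoissonPointProcess lam t μ) [NullSingletonClass lam] :
    ∀ᵐ p ∂(iidLaw μ).prod (iidLaw μ), p ∈ disjointPairs G := by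
  refine (Measure.measure_prod_null measurableSet_disjointPairs.compl).2
    (Eventually.of_forall fun ω => ?_)
  have h : Prod.mk ω ⁻¹' (disjointPairs G)ᶜ = (avoid (Prod.fst ⁻¹' ω.support))ᶜ := by
    ext ω'
    rw [mem_compl_iff, mem_avoid_preimage_fst, disjoint_comm]
    rfl
  -- With the first configuration fixed, its support is countable, hence null for the atomless
  -- `lam`.
  have h0 : lam.prod (volume : Measure I) (Prod.fst ⁻¹' ω.support) = 0 := by
    rw [← prod_univ, Measure.prod_prod, ω.countable_support.measure_zero, zero_mul]
  change iidLaw μ (Prod.mk ω ⁻¹' (disjointPairs G)ᶜ) = 0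
  rw [h]
  exact hμ.iidLaw_compl_avoid_eq_zero
    (ω.countable_support.measurableSet.preimage measurable_fst) h0

theorem measurePreserving_exchange (hμ : IsPoissonPointProcess lam t μ) [NullSingletonClass lam]
    {D : Set I} (hD : MeasurableSet D) :
    MeasurePreserving (exchange (G := G) D) ((iidLaw μ).prod (iidLaw μ))
      ((iidLaw μ).prod (iidLaw μ)) := by
  refine ⟨measurable_exchange hD, (prod_ext_of_avoid fun U V hU hUK hV hVK => ?_).symm⟩
  rw [Measure.map_apply (measurable_exchange hD)
    ((measurableSet_avoid hU).prod (measurableSet_avoid hV)),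
    ← hμ.iidLaw_avoid_mul hD hU hV hUK hVK, ← Measure.prod_prod]
  refine measure_congr ?_
  filter_upwards [hμ.ae_mem_disjointPairs] with p hp
  exact propext (exchange_mem_avoid_prod D hp)

/-- The exchange of the points with marks in `D`, as a measure preserving automorphism. -/
def exchangeMPEquiv (hμ : IsPoissonPointProcess lam t μ) [NullSingletonClass lam]
    {D : Set I} (hD : MeasurableSet D) : MPEquiv ((iidLaw μ).prod (iidLaw μ)) :=
  ⟨exchangeEquiv hD, hμ.measurePreserving_exchange hD⟩

theorem mk_exchangeMPEquiv_empty (hμ : IsPoissonPointProcess lam t μ) [NullSingletonClass lam] :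
    MPAut.mk (hμ.exchangeMPEquiv MeasurableSet.empty) = 1 :=
  Quotient.sound (Eventually.of_forall exchange_empty)

/-- Full measure of `D` suffices, which matters because `Iio 1` omits the mark `1`. -/
theorem mk_exchangeMPEquiv_of_ae (hμ : IsPoissonPointProcess lam t μ) [NullSingletonClass lam]
    {D : Set I} (hD : MeasurableSet D) (h : volume Dᶜ = 0) :
    MPAut.mk (hμ.exchangeMPEquiv hD) = MPAut.flip (iidLaw μ) := by
  refine Quotient.sound ?_
  have h0 : lam.prod (volume : Measure I) (Prod.snd ⁻¹' Dᶜ) = 0 := by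
    rw [← univ_prod, Measure.prod_prod, h, mul_zero]
  have hae : ∀ᵐ ω ∂(iidLaw μ), ω ∈ avoid (Prod.snd ⁻¹' Dᶜ : Set (G × I)) :=
    hμ.iidLaw_compl_avoid_eq_zero (hD.compl.preimage measurable_snd) h0
  filter_upwards [hμ.ae_mem_disjointPairs, Measure.quasiMeasurePreserving_fst.ae hae,
    Measure.quasiMeasurePreserving_snd.ae hae] with p hp h1 h2
  exact exchange_eq_swap D hp h1 h2

/-- In each copy, the expected number of points in `L` with mark between `r` and `s` is at most `t *
lam (Prod.fst '' L) * |s - r|`. -/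
theorem tendsto_measure_symmDiff_exchange_avoid (hμ : IsPoissonPointProcess lam t μ)
    {U V L : Set (G × I)} (hL : IsCompact L) (hU : U ⊆ L) (hV : V ⊆ L) (r : I) :
    Tendsto (fun s => (iidLaw μ).prod (iidLaw μ)
      ((exchange (Iio s) ⁻¹' (avoid U ×ˢ avoid V)) ∆
        (exchange (Iio r) ⁻¹' (avoid U ×ˢ avoid V)))) (𝓝 r) (𝓝 0) := by
  set C : ℝ≥0∞ := t * lam (Prod.fst '' L) with hCdef
  have hC : C ≠ ∞ := ENNReal.mul_ne_top ENNReal.coe_ne_top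
    (hL.image continuous_fst).measure_lt_top.ne
  have hbound : ∀ s : I, (iidLaw μ).prod (iidLaw μ)
      ((exchange (Iio s) ⁻¹' (avoid U ×ˢ avoid V)) ∆
        (exchange (Iio r) ⁻¹' (avoid U ×ˢ avoid V))) ≤ C * edist s r + C * edist s r := by
    intro s
    have hDm : MeasurableSet (Prod.snd ⁻¹' (Iio s ∆ Iio r) : Set (G × I)) :=
      (measurableSet_Iio.symmDiff measurableSet_Iio).preimage measurable_snd
    have hN : MeasurableSet (L ∩ Prod.snd ⁻¹' (Iio s ∆ Iio r)) := hL.measurableSet.inter hDm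
    have hν : iidLaw μ (avoid (L ∩ Prod.snd ⁻¹' (Iio s ∆ Iio r)))ᶜ ≤ C * edist s r := by
      refine (hμ.iidLaw_compl_avoid_le hN hL inter_subset_left).trans ?_
      have hsub : L ∩ Prod.snd ⁻¹' (Iio s ∆ Iio r) ⊆ (Prod.fst '' L) ×ˢ (Iio s ∆ Iio r) :=
        fun q hq => ⟨⟨q, hq.1, rfl⟩, hq.2⟩
      rw [hCdef, mul_assoc]
      gcongr
      refine (measure_mono hsub).trans ?_
      rw [Measure.prod_prod]
      gcongr
      exact volume_symmDiff_Iio_le r s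
    refine (measure_mono (symmDiff_preimage_exchange_subset hU hV _ _)).trans
      ((measure_union_le _ _).trans (add_le_add ?_ ?_))
    · rw [measurePreserving_fst.measure_preimage
        (measurableSet_avoid hN).compl.nullMeasurableSet]
      exact hν
    · rw [measurePreserving_snd.measure_preimage
        (measurableSet_avoid hN).compl.nullMeasurableSet]
      exact hν
  have hlim : Tendsto (fun s : I => C * edist s r + C * edist s r) (𝓝 r) (𝓝 0) := by
    have h1 : Tendsto (fun s : I => edist s r) (𝓝 r) (𝓝 0) :=
      tendsto_iff_edist_tendsto_0.1 tendsto_id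
    have h2 := ENNReal.Tendsto.const_mul h1 (Or.inr hC)
    rw [mul_zero] at h2
    simpa using h2.add h2
  exact tendsto_of_tendsto_of_tendsto_of_le_of_le tendsto_const_nhds hlim (fun _ => zero_le)
    hbound

/-- The exchange of the points with marks below `s` depends continuously on `s`. -/
theorem tendsto_measure_symmDiff_exchange (hμ : IsPoissonPointProcess lam t μ)
    [NullSingletonClass lam] (r : I) {A : Set (MarkedConfig G × MarkedConfig G)}
    (hA : MeasurableSet A) :
    Tendsto (fun s => (iidLaw μ).prod (iidLaw μ)
      ((exchange (Iio s) ⁻¹' A) ∆ (exchange (Iio r) ⁻¹' A))) (𝓝 r) (𝓝 0) := by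
  have hspan : IsCountablySpanning (avoidSets (G := G)) :=
    ⟨fun _ => univ, fun _ => univ_mem_avoidSets, iUnion_const _⟩
  induction A, hA using MeasurableSpace.induction_on_inter
    (generateFrom_eq_prod (eq_generateFrom_avoidSets (G := G)).symm
      (eq_generateFrom_avoidSets (G := G)).symm hspan hspan).symm
    (isPiSystem_avoidSets.prod isPiSystem_avoidSets) with
  | empty => simp
  | basic A hA =>
    obtain ⟨_, ⟨U, ⟨-, K, hK, hUK⟩, rfl⟩, _, ⟨V, ⟨-, L, hL, hVL⟩, rfl⟩, rfl⟩ := hA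
    exact hμ.tendsto_measure_symmDiff_exchange_avoid (hK.union hL)
      (hUK.trans subset_union_left) (hVL.trans subset_union_right) r
  | compl A hA ih =>
    simpa only [preimage_compl, compl_symmDiff_compl] using ih
  | iUnion A hd hA ih =>
    set ρ := (iidLaw μ).prod (iidLaw μ) with hρ
    have hpre : ∀ (s : I) (B), MeasurableSet B → ρ (exchange (Iio s) ⁻¹' B) = ρ B :=
      fun s B hB => (hμ.measurePreserving_exchange measurableSet_Iio).measure_preimage
        hB.nullMeasurableSet
    -- Invariance of `ρ` gives a summable bound that does not depend on `s`, so dominated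
    -- convergence for counting measure passes the limit through the sum.
    have hle : ∀ (s : I) i, ρ ((exchange (Iio s) ⁻¹' A i) ∆ (exchange (Iio r) ⁻¹' A i)) ≤
        ρ (A i) + ρ (A i) := by
      intro s i
      refine (measure_mono symmDiff_subset_union).trans ((measure_union_le _ _).trans ?_)
      rw [hpre s _ (hA i), hpre r _ (hA i)]
    have hsum : ∑' i, (ρ (A i) + ρ (A i)) ≠ ∞ := by
      rw [ENNReal.tsum_add, ← measure_iUnion hd hA]
      exact ENNReal.add_ne_top.2 ⟨measure_ne_top _ _, measure_ne_top _ _⟩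
    have hlim : Tendsto (fun s => ∑' i, ρ ((exchange (Iio s) ⁻¹' A i) ∆
        (exchange (Iio r) ⁻¹' A i))) (𝓝 r) (𝓝 0) := by
      have h := tendsto_lintegral_filter_of_dominated_convergence (μ := Measure.count) (l := 𝓝 r)
        (F := fun s i => ρ ((exchange (Iio s) ⁻¹' A i) ∆ (exchange (Iio r) ⁻¹' A i)))
        (f := fun _ => 0) (fun i => ρ (A i) + ρ (A i))
        (Eventually.of_forall fun _ => .of_discrete)
        (Eventually.of_forall fun s => Eventually.of_forall (hle s))
        (by rwa [lintegral_count]) (Eventually.of_forall ih)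
      simpa only [lintegral_count, tsum_zero] using h
    refine tendsto_of_tendsto_of_tendsto_of_le_of_le tendsto_const_nhds hlim
      (fun _ => zero_le) fun s => ?_
    simp only [preimage_iUnion]
    exact (measure_mono iUnion_symmDiff_iUnion_subset).trans (measure_iUnion_le _)

theorem continuous_mk_exchangeMPEquiv (hμ : IsPoissonPointProcess lam t μ)
    [NullSingletonClass lam] :
    Continuous fun s : I => MPAut.mk (hμ.exchangeMPEquiv (measurableSet_Iio (a := s))) := by
  refine continuous_iInf_rng.2 fun A => continuous_iInf_rng.2 fun B => continuous_induced_rng.2 ?_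
  refine continuous_iff_continuousAt.2 fun r => ?_
  set ρ := (iidLaw μ).prod (iidLaw μ) with hρ
  have hval : ∀ s : I, MPAut.measureSymmDiff A B
      (MPAut.mk (hμ.exchangeMPEquiv (measurableSet_Iio (a := s)))) =
      ρ ((exchange (Iio s) ⁻¹' A.1) ∆ B.1) := by
    intro s
    rw [← image_exchangeEquiv measurableSet_Iio]
    rfl
  have hlim := hμ.tendsto_measure_symmDiff_exchange r A.2
  simp only [ContinuousAt, Function.comp_def, hval]
  -- The triangle inequality for `ρ (· ∆ ·)` squeezes the value at `s` between the value at `r` plus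
  -- and minus a quantity tending to `0`.
  have hadd := (tendsto_const_nhds (x := ρ ((exchange (Iio r) ⁻¹' A.1) ∆ B.1))).add hlim
  have hsub := ENNReal.Tendsto.sub
    (tendsto_const_nhds (x := ρ ((exchange (Iio r) ⁻¹' A.1) ∆ B.1))) hlim
    (Or.inr ENNReal.zero_ne_top)
  rw [add_zero] at hadd
  rw [tsub_zero] at hsub
  refine tendsto_of_tendsto_of_tendsto_of_le_of_le hsub hadd (fun s => ?_) fun s => ?_
  · refine tsub_le_iff_right.2 ((measure_symmDiff_le _ (exchange (Iio s) ⁻¹' A.1) _).trans ?_)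
    rw [symmDiff_comm, add_comm]
  · refine (measure_symmDiff_le _ (exchange (Iio r) ⁻¹' A.1) _).trans ?_
    rw [add_comm]

end Exchange

/-! ### Invariance and malleability -/

section Action

variable {G : Type*} [Group G] [TopologicalSpace G] [IsTopologicalGroup G] [MeasurableSpace G]
  [BorelSpace G] [T2Space G] [LocallyCompactSpace G] [SecondCountableTopology G]
  {μ : Measure (Config G)} {lam : Measure G} {t : ℝ≥0} [IsFiniteMeasureOnCompacts lam]
  [lam.IsMulLeftInvariant] [IsProbabilityMeasure μ]

theorem smulInvariantMeasure_iidLaw (hμ : IsPoissonPointProcess lam t μ) :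
    SMulInvariantMeasure G (MarkedConfig G) (iidLaw μ) := by
  refine ⟨fun g s hs => ?_⟩
  have hg : Measurable fun ω : MarkedConfig G => g • ω := measurable_const_smul g
  suffices h : iidLaw μ = (iidLaw μ).map fun ω => g • ω by
    conv_rhs => rw [h, Measure.map_apply hg hs]
  refine ext_of_avoid fun V hV hVK => ?_
  obtain ⟨K, hK, hVK⟩ := hVK
  have hpre : (fun ω : MarkedConfig G => g • ω) ⁻¹' avoid V = avoid (shift g ⁻¹' V) :=
    Set.ext fun ω => smul_mem_avoid
  have hshift : MeasurePreserving (shift g) (lam.prod (volume : Measure I)) (lam.prod volume) :=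
    (measurePreserving_mul_left lam g).prod (MeasurePreserving.id volume)
  rw [Measure.map_apply hg (measurableSet_avoid hV), hpre, hμ.iidLaw_avoid hV hK hVK,
    hμ.iidLaw_avoid (hV.preimage hshift.measurable) ((shift g).isCompact_preimage.2 hK)
      (preimage_mono hVK), hshift.measure_preimage hV.nullMeasurableSet]

/-- Another representative `S` agrees with the exchange only almost everywhere; invariance of the
measure ensures agreement at `g • p` as well as at `p`. -/
theorem commutesWithDiagonal_exchange (hμ : IsPoissonPointProcess lam t μ)
    [NullSingletonClass lam] {D : Set I} (hD : MeasurableSet D) :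
    CommutesWithDiagonal G (MPAut.mk (hμ.exchangeMPEquiv hD)) := by
  intro S hS g
  have := hμ.smulInvariantMeasure_iidLaw
  have hg : MeasurePreserving (fun ω : MarkedConfig G => g • ω) (iidLaw μ) (iidLaw μ) :=
    measurePreserving_smul g (iidLaw μ)
  have hae : ∀ᵐ p ∂(iidLaw μ).prod (iidLaw μ), S.1 p = exchange D p := Quotient.exact hS
  filter_upwards [hae, (hg.prod hg).quasiMeasurePreserving.ae hae] with p hp hgp
  rw [hp, ← exchange_smul]
  exact hgp

theorem isMalleable_iidLaw (hμ : IsPoissonPointProcess lam t μ) [NullSingletonClass lam] :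
    IsMalleable G (iidLaw μ) := by
  refine ⟨⟨⟨_, hμ.continuous_mk_exchangeMPEquiv⟩, ?_, ?_⟩, fun s =>
    hμ.commutesWithDiagonal_exchange measurableSet_Iio⟩
  · have h : Iio (0 : I) = ∅ := Iio_eq_empty_iff.2 isMin_bot
    refine Eq.trans ?_ hμ.mk_exchangeMPEquiv_empty
    simp only [h]
  · refine hμ.mk_exchangeMPEquiv_of_ae measurableSet_Iio ?_
    rw [compl_Iio, unitInterval.volume_Ici]
    simp

end Action

end IsPoissonPointProcess

/-- In a nondiscrete group the identity is not isolated, and this rules out atoms of Haar measure.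
-/
theorem nullSingletonClass_of_not_discreteTopology {G : Type*} [Group G] [TopologicalSpace G]
    [IsTopologicalGroup G] [T2Space G] [LocallyCompactSpace G] [MeasurableSpace G] [BorelSpace G]
    (hG : ¬ DiscreteTopology G) (lam : Measure G) [lam.IsHaarMeasure] :
    NullSingletonClass lam := by
  have : (𝓝[≠] (1 : G)).NeBot := by
    by_contra h
    refine hG (discreteTopology_of_isOpen_singleton_one ?_)
    rwa [isOpen_singleton_iff_punctured_nhds, ← not_neBot]
  infer_instance

end

theorem mainTheorem10 {G : Type*} [Group G] [TopologicalSpace G] [IsTopologicalGroup G]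
    [T2Space G] [LocallyCompactSpace G] [SecondCountableTopology G]
    [MeasurableSpace G] [BorelSpace G] (hG : ¬ DiscreteTopology G)
    (lam : Measure G) [lam.IsHaarMeasure] (t : ℝ≥0) (ht : 0 < t)
    (μ : Measure (Config G)) [IsProbabilityMeasure μ] (hμ : IsPoissonPointProcess lam t μ) :
    IsProbabilityMeasure (iidLaw μ) ∧
    SMulInvariantMeasure G (MarkedConfig G) (iidLaw μ) ∧
    IsMalleable G (iidLaw μ) := by
  have := nullSingletonClass_of_not_discreteTopology hG lam
  exact ⟨inferInstance, hμ.smulInvariantMeasure_iidLaw, hμ.isMalleable_iidLaw⟩
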